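/- Let $n\ge 1$, $t>0$, $x_0\in\mathbb{R}^n$. Let $A_{\rm int}\in\mathbb{R}^{n\times n}$ have ones on the first superdiagonal and zeros elsewhere, let $b_{\rm con}=(0,\dots,0,1)^\top$, and consider the integrator $\dot x=A_{\rm int}x+b_{\rm con}u$, $x(0)=x_0$, with input constraint $u_{\min}(s)\le u(s)\le u_{\max}(s)$ for all $s\in[0,t]$. The range $[u_{\min}(s),u_{\max}(s)]$ is one of the following: (a) it is given by continuous functions $u_{\min}\le u_{\max}$ on $[0,t]$; or (b) it is induced by a controllable system $\dot z=Az+bv$, $z(0)=z_0$, $v\in[v_{\min},v_{\max}]$ with constants $v_{\min}\le v_{\max}$, as follows. Let $q^\top$ be the last row of the inverse of $(b,Ab,\dots,A^{n-1}b)$, let $M$ be the matrix with rows $q^\top,q^\top A,\dots,q^\top A^{n-1}$, let $A_{\rm con}=MAM^{-1}$, and let $c=(c_0,\dots,c_{n-1})^\top$ where $\lambda^n+c_{n-1}\lambda^{n-1}+\dots+c_0$ is the characteristic polynomial of $A$. Then $x_0=Mz_0$ and $$u_{\min}(s)=-\langle c,e^{sA_{\rm con}}Mz_0\rangle+\inf_v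 I_s(v),\qquad u_{\max}(s)=-\langle c,e^{sA_{\rm con}}Mz_0\rangle+\sup_v I_s(v),$$ where $I_s(v)=v(s)-\int_0^s\langle c,e^{(s-\tau)A_{\rm con}}b_{\rm con}\rangle v(\tau)\,d\tau$ and $v$ ranges over the continuous functions $[0,s]\to[v_{\min},v_{\max}]$. Let $\mathcal{X}_t$ be the set of states $x(t)$ reached with measurable inputs $u$ satisfying the constraint, and let $\mathcal{X}^{c}_t$ be the set of those reached with continuous ones. Put $\mathcal{W}_t=\{\sigma\in\mathbb{R}^{n-1}: 0\le\sigma_1\le\dots\le\sigma_{n-1}\le t\}$, $\sigma_0=0$, $\sigma_n=t$, $\mu=(u_{\max}-u_{\min})/2$, $\nu=(u_{\max}+u_{\min})/2$, $$\xi(s)=\Big(\tfrac{s^{n-1}}{(n-1)!},\tfrac{s^{n-2}}{(n-2)!},\dots,s,1\Big)^\top,\quad \chi_k=\sum_{\ell=k}^n\tfrac{t^{\ell-k}}{(\ell-k)!}(x_0)_\ell,\quad \eta_t=\chi+\int_0^t\nu(s)\xi(t-s)\,ds,$$ $$x^{\rm upper}(\sigma)=\eta_t+\sum_{k=1}^{n}(-1)^{k-1}\int_{\sigma_{k-1}}^{\sigma_k}\mu(s)\xi(t-s)\,ds,\qquad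 x^{\rm lower}(\sigma)=\eta_t-\sum_{k=1}^{n}(-1)^{k-1}\int_{\sigma_{k-1}}^{\sigma_k}\mu(s)\xi(t-s)\,ds,$$ and $\pi(\sigma,\lambda)=\lambda x^{\rm upper}(\sigma)+(1-\lambda)x^{\rm lower}(\sigma)$. Then: 1. $\pi$ maps $\mathcal{W}_t\times[0,1]$ into $\mathcal{X}_t$, and $\pi:\mathcal{W}_t\times[0,1]\to\mathcal{X}_t$ is surjective. 2. For continuous inputs: every $x\in\mathcal{X}^c_t$ equals $\pi(\sigma,\lambda)$ for some $(\sigma,\lambda)\in\mathcal{W}_t\times[0,1]$, and $\pi(\mathcal{W}_t\times[0,1])=\overline{\mathcal{X}^c_t}$. 3. For every $\sigma\in\mathcal{W}_t$, the points $x^{\rm upper}(\sigma)$ and $x^{\rm lower}(\sigma)$ lie on the boundary of $\mathcal{X}_t$ and on the boundary of $\mathcal{X}^c_t$, and they are antipodal about $\eta_t$: $x^{\rm lower}(\sigma)-\eta_t=-(x^{\rm upper}(\sigma)-\eta_t)$. -/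

import Mathlib

open Set MeasureTheory
open scoped Matrix Nat

namespace LTIReach

/-! The state dimension is `n = m + 1`; coordinates are indexed by `Fin (m + 1)`. -/

section Integrator

/-- The state matrix of the integrator chain: ones on the first superdiagonal, zeros elsewhere. -/
def Aint (m : ℕ) : Matrix (Fin (m + 1)) (Fin (m + 1)) ℝ :=
  Matrix.of fun i j => if (i : ℕ) + 1 = (j : ℕ) then 1 else 0

/-- The input vector `(0, …, 0, 1)`. -/
def bcon (m : ℕ) : Fin (m + 1) → ℝ :=
  fun i => if i = Fin.last m then 1 else 0

/-- `x` is a classical (differentiable) solution on `[0, t]` of `x' = Aint x + bcon u`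
with `x 0 = x₀`. -/
def IsClassicalTrajectory {m : ℕ} (t : ℝ) (x₀ : Fin (m + 1) → ℝ) (u : ℝ → ℝ)
    (x : ℝ → Fin (m + 1) → ℝ) : Prop :=
  x 0 = x₀ ∧ ∀ s ∈ Icc 0 t,
    HasDerivWithinAt x (Aint m *ᵥ x s + u s • bcon m) (Icc 0 t) s

/-- `x` is a Carathéodory solution on `[0, t]` of `x' = Aint x + bcon u` with `x 0 = x₀`, that is,
a continuous solution of the corresponding integral equation. -/
def IsTrajectory {m : ℕ} (t : ℝ) (x₀ : Fin (m + 1) → ℝ) (u : ℝ → ℝ)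
    (x : ℝ → Fin (m + 1) → ℝ) : Prop :=
  ContinuousOn x (Icc 0 t) ∧ ∀ s ∈ Icc 0 t,
    x s = x₀ + ∫ τ in (0 : ℝ)..s, (Aint m *ᵥ x τ + u τ • bcon m)

/-- States reached at time `t` from `x₀` with continuous inputs satisfying
`umin s ≤ u s ≤ umax s` on `[0, t]`. -/
def contReachSet {m : ℕ} (t : ℝ) (x₀ : Fin (m + 1) → ℝ) (umin umax : ℝ → ℝ) :
    Set (Fin (m + 1) → ℝ) :=
  {y | ∃ (u : ℝ → ℝ) (x : ℝ → Fin (m + 1) → ℝ), ContinuousOn u (Icc 0 t) ∧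
    (∀ s ∈ Icc 0 t, u s ∈ Icc (umin s) (umax s)) ∧ IsClassicalTrajectory t x₀ u x ∧ x t = y}

/-- States reached at time `t` from `x₀` with measurable inputs satisfying
`umin s ≤ u s ≤ umax s` on `[0, t]`. -/
def reachSet {m : ℕ} (t : ℝ) (x₀ : Fin (m + 1) → ℝ) (umin umax : ℝ → ℝ) :
    Set (Fin (m + 1) → ℝ) :=
  {y | ∃ (u : ℝ → ℝ) (x : ℝ → Fin (m + 1) → ℝ), Measurable u ∧
    (∀ s ∈ Icc 0 t, u s ∈ Icc (umin s) (umax s)) ∧ IsTrajectory t x₀ u x ∧ x t = y}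

end Integrator

section Boundary

/-- The Weyl chamber `0 ≤ σ₁ ≤ … ≤ σ_{n-1} ≤ t` in `ℝ^{n-1}`. -/
def weyl (m : ℕ) (t : ℝ) : Set (Fin m → ℝ) :=
  {σ | Monotone σ ∧ ∀ i, σ i ∈ Icc 0 t}

/-- Half width of the input range. -/
noncomputable def mu (umin umax : ℝ → ℝ) (s : ℝ) : ℝ := (umax s - umin s) / 2

/-- Midpoint of the input range. -/
noncomputable def nu (umin umax : ℝ → ℝ) (s : ℝ) : ℝ := (umax s + umin s) / 2

/-- The vector `(s^(n-1)/(n-1)!, s^(n-2)/(n-2)!, …, s, 1)`. -/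
noncomputable def xi (m : ℕ) (s : ℝ) : Fin (m + 1) → ℝ :=
  fun k => s ^ (m - (k : ℕ)) / ((m - (k : ℕ))! : ℝ)

/-- The free motion `χ_k = ∑_{ℓ ≥ k} t^(ℓ-k)/(ℓ-k)! x₀_ℓ`. -/
noncomputable def chi {m : ℕ} (t : ℝ) (x₀ : Fin (m + 1) → ℝ) : Fin (m + 1) → ℝ :=
  fun k => ∑ l : Fin (m + 1),
    if k ≤ l then t ^ ((l : ℕ) - (k : ℕ)) / (((l : ℕ) - (k : ℕ))! : ℝ) * x₀ l else 0

/-- The center `η_t`. -/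
noncomputable def eta {m : ℕ} (t : ℝ) (x₀ : Fin (m + 1) → ℝ) (umin umax : ℝ → ℝ) :
    Fin (m + 1) → ℝ :=
  chi t x₀ + ∫ s in (0 : ℝ)..t, nu umin umax s • xi m (t - s)

/-- The nodes `(σ₀, σ₁, …, σ_n) = (0, σ₁, …, σ_{n-1}, t)`. -/
def nodes {m : ℕ} (t : ℝ) (σ : Fin m → ℝ) : Fin (m + 2) → ℝ :=
  Fin.cons (α := fun _ => ℝ) 0 (Fin.snoc (α := fun _ => ℝ) σ t)

/-- The alternating sum `∫_{0}^{σ₁} - ∫_{σ₁}^{σ₂} + … + (-1)^(n-1) ∫_{σ_{n-1}}^{t}` of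
`μ(s) ξ(t - s) ds`. -/
noncomputable def alternating {m : ℕ} (t : ℝ) (umin umax : ℝ → ℝ) (σ : Fin m → ℝ) :
    Fin (m + 1) → ℝ :=
  ∑ k : Fin (m + 1), (-1 : ℝ) ^ (k : ℕ) •
    ∫ s in (nodes t σ k.castSucc)..(nodes t σ k.succ), mu umin umax s • xi m (t - s)

noncomputable def xUpper {m : ℕ} (t : ℝ) (x₀ : Fin (m + 1) → ℝ) (umin umax : ℝ → ℝ)
    (σ : Fin m → ℝ) : Fin (m + 1) → ℝ :=
  eta t x₀ umin umax + alternating t umin umax σ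

noncomputable def xLower {m : ℕ} (t : ℝ) (x₀ : Fin (m + 1) → ℝ) (umin umax : ℝ → ℝ)
    (σ : Fin m → ℝ) : Fin (m + 1) → ℝ :=
  eta t x₀ umin umax - alternating t umin umax σ

/-- The map `π(σ, r) = r x^upper(σ) + (1 - r) x^lower(σ)`. -/
noncomputable def piMap {m : ℕ} (t : ℝ) (x₀ : Fin (m + 1) → ℝ) (umin umax : ℝ → ℝ)
    (p : (Fin m → ℝ) × ℝ) : Fin (m + 1) → ℝ :=
  p.2 • xUpper t x₀ umin umax p.1 + (1 - p.2) • xLower t x₀ umin umax p.1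

end Boundary

section LTI

/-- The controllability matrix `(b, A b, …, A^(n-1) b)`. -/
def ctrbMatrix {m : ℕ} (A : Matrix (Fin (m + 1)) (Fin (m + 1)) ℝ) (b : Fin (m + 1) → ℝ) :
    Matrix (Fin (m + 1)) (Fin (m + 1)) ℝ :=
  Matrix.of fun i j => (A ^ (j : ℕ) *ᵥ b) i

/-- The pair `(A, b)` is controllable: the controllability matrix has full rank. -/
def IsControllable {m : ℕ} (A : Matrix (Fin (m + 1)) (Fin (m + 1)) ℝ)
    (b : Fin (m + 1) → ℝ) : Prop :=
  (ctrbMatrix A b).rank = m + 1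

/-- The matrix with rows `q, q A, …, q A^(n-1)`, where `q` is the last row of the inverse of the
controllability matrix. -/
noncomputable def Mmat {m : ℕ} (A : Matrix (Fin (m + 1)) (Fin (m + 1)) ℝ)
    (b : Fin (m + 1) → ℝ) : Matrix (Fin (m + 1)) (Fin (m + 1)) ℝ :=
  Matrix.of fun i => (ctrbMatrix A b)⁻¹ (Fin.last m) ᵥ* A ^ (i : ℕ)

/-- The state matrix in controllable canonical form. -/
noncomputable def Acon {m : ℕ} (A : Matrix (Fin (m + 1)) (Fin (m + 1)) ℝ)
    (b : Fin (m + 1) → ℝ) : Matrix (Fin (m + 1)) (Fin (m + 1)) ℝ :=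
  Mmat A b * A * (Mmat A b)⁻¹

/-- The coefficients `c₀, …, c_{n-1}` of the monic characteristic polynomial of `A`. -/
noncomputable def cvec {m : ℕ} (A : Matrix (Fin (m + 1)) (Fin (m + 1)) ℝ) : Fin (m + 1) → ℝ :=
  fun i => A.charpoly.coeff (i : ℕ)

/-- The kernel `f(τ) = ⟨c, exp((s - τ) Acon) bcon⟩`. -/
noncomputable def fker {m : ℕ} (A : Matrix (Fin (m + 1)) (Fin (m + 1)) ℝ)
    (b : Fin (m + 1) → ℝ) (s τ : ℝ) : ℝ :=
  cvec A ⬝ᵥ (NormedSpace.exp ((s - τ) • Acon A b) *ᵥ bcon m)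

/-- The functional `I(v) = v(s) - ∫₀ˢ f(τ) v(τ) dτ`. -/
noncomputable def Ifun {m : ℕ} (A : Matrix (Fin (m + 1)) (Fin (m + 1)) ℝ)
    (b : Fin (m + 1) → ℝ) (s : ℝ) (v : ℝ → ℝ) : ℝ :=
  v s - ∫ τ in (0 : ℝ)..s, fker A b s τ * v τ

/-- Continuous inputs on `[0, s]` with values in `[vmin, vmax]`. -/
def contInputs (s vmin vmax : ℝ) : Set (ℝ → ℝ) :=
  {v | ContinuousOn v (Icc 0 s) ∧ ∀ τ ∈ Icc 0 s, v τ ∈ Icc vmin vmax}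

noncomputable def Imin {m : ℕ} (A : Matrix (Fin (m + 1)) (Fin (m + 1)) ℝ)
    (b : Fin (m + 1) → ℝ) (vmin vmax s : ℝ) : ℝ :=
  sInf (Ifun A b s '' contInputs s vmin vmax)

noncomputable def Imax {m : ℕ} (A : Matrix (Fin (m + 1)) (Fin (m + 1)) ℝ)
    (b : Fin (m + 1) → ℝ) (vmin vmax s : ℝ) : ℝ :=
  sSup (Ifun A b s '' contInputs s vmin vmax)

/-- The lower end of the induced time-varying input range. -/
noncomputable def uMinLTI {m : ℕ} (A : Matrix (Fin (m + 1)) (Fin (m + 1)) ℝ)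
    (b z₀ : Fin (m + 1) → ℝ) (vmin vmax s : ℝ) : ℝ :=
  -(cvec A ⬝ᵥ (NormedSpace.exp (s • Acon A b) *ᵥ (Mmat A b *ᵥ z₀))) + Imin A b vmin vmax s

/-- The upper end of the induced time-varying input range. -/
noncomputable def uMaxLTI {m : ℕ} (A : Matrix (Fin (m + 1)) (Fin (m + 1)) ℝ)
    (b z₀ : Fin (m + 1) → ℝ) (vmin vmax s : ℝ) : ℝ :=
  -(cvec A ⬝ᵥ (NormedSpace.exp (s • Acon A b) *ᵥ (Mmat A b *ᵥ z₀))) + Imax A b vmin vmax s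

/-- The initial state and the input range are those induced by a controllable system
`z' = A z + b v`, `z 0 = z₀`, `v ∈ [vmin, vmax]`. -/
def IsInducedByLTI {m : ℕ} (x₀ : Fin (m + 1) → ℝ) (umin umax : ℝ → ℝ) : Prop :=
  ∃ (A : Matrix (Fin (m + 1)) (Fin (m + 1)) ℝ) (b z₀ : Fin (m + 1) → ℝ) (vmin vmax : ℝ),
    IsControllable A b ∧ vmin ≤ vmax ∧ x₀ = Mmat A b *ᵥ z₀ ∧
    umin = uMinLTI A b z₀ vmin vmax ∧ umax = uMaxLTI A b z₀ vmin vmax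

/-- The input range is given by arbitrary continuous curves `umin ≤ umax` on `[0, t]`. -/
def IsContinuousRange (t : ℝ) (umin umax : ℝ → ℝ) : Prop :=
  ContinuousOn umin (Icc 0 t) ∧ ContinuousOn umax (Icc 0 t) ∧ ∀ s ∈ Icc 0 t, umin s ≤ umax s

end LTI

end LTIReach

/-! By variation of constants, writing `u = ν + w μ` with `|w| ≤ 1` identifies the reach set with
`η_t + Z`, where `Z` is the zonoid `{∫₀ᵗ w(s) μ(s) ξ(t - s) ds}`. A linear functional `f` is
maximized over `Z` by `w(s) = sign f(ξ(t - s))`; since `f(ξ(t - s))` is a nonzero polynomial in `s`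
of degree less than `n`, this sign is that of a bang-bang control with at most `n - 1` switching
times, and the maximizer is unique. Hence every boundary point of `Z` is `± (x^upper(σ) - η_t)`;
conversely every such point maximizes the functional whose polynomial has its roots at the `σ_i`.
As `Z` is convex and compact, scaling its boundary points fills it. Density of continuous functions
in `L¹` makes the continuous-input reach set dense. The range induced by a controllable system is
continuous because `v ↦ I_s(v)` is integration against a measure, so that its extrema over
continuous inputs are given by total variation. -/

namespace LTIReach

section ConvexGeometry

variable {E : Type*} [NormedAddCommGroup E] [NormedSpace ℝ E]

theorem isCompact_convexHull [FiniteDimensional ℝ E] {V : Set E} (hV : IsCompact V) :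
    IsCompact (convexHull ℝ V) := by
  let combine : (Fin (Module.finrank ℝ E + 1) → ℝ) × (Fin (Module.finrank ℝ E + 1) → E) → E :=
    fun p => ∑ i, p.1 i • p.2 i
  have himage : convexHull ℝ V =
      combine '' (stdSimplex ℝ (Fin (Module.finrank ℝ E + 1)) ×ˢ univ.pi fun _ => V) := by
    refine Subset.antisymm (fun x hx => ?_) ?_
    · obtain ⟨ι, _, z, w, hzV, hz, hw0, hw1, rfl⟩ := eq_pos_convex_span_of_mem_convexHull hx
      obtain ⟨v, hv⟩ : V.Nonempty := convexHull_nonempty_iff.1 ⟨_, hx⟩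
      have hcard : Fintype.card ι ≤ Fintype.card (Fin (Module.finrank ℝ E + 1)) := by
        simpa using hz.card_le_finrank_succ.trans (by gcongr; exact Submodule.finrank_le _)
      obtain ⟨e⟩ := Function.Embedding.nonempty_of_card_le hcard
      have hsupp : ∀ j ∉ range e, Function.extend e w 0 j = 0 := fun j hj =>
        Function.extend_apply' _ _ _ hj
      refine ⟨(Function.extend e w 0, Function.extend e z fun _ => v), ⟨⟨fun j => ?_, ?_⟩,
        fun j _ => ?_⟩,
        (Fintype.sum_of_injective e e.injective _ _ (fun j hj => ?_) fun i => ?_).symm⟩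
      · obtain ⟨i, rfl⟩ | hj := em (j ∈ range e)
        · simpa [e.injective.extend_apply] using (hw0 i).le
        · exact (hsupp j hj).ge
      · rw [← hw1]
        exact (Fintype.sum_of_injective e e.injective _ _ hsupp fun i =>
          (e.injective.extend_apply _ _ i).symm).symm
      · obtain ⟨i, rfl⟩ | hj := em (j ∈ range e)
        · simpa [e.injective.extend_apply] using hzV (mem_range_self i)
        · simpa [Function.extend_apply' _ _ _ hj] using hv
      · simp [hsupp j hj]
      · simp [e.injective.extend_apply]
    · rintro _ ⟨⟨w, z⟩, ⟨hw, hz⟩, rfl⟩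
      exact (convex_convexHull ℝ V).sum_mem (fun i _ => hw.1 i) hw.2 fun i _ =>
        subset_convexHull ℝ V (hz i trivial)
  rw [himage]
  exact ((isCompact_stdSimplex ℝ _).prod (isCompact_univ_pi fun _ => hV)).image
    (by fun_prop)

/-- A supporting hyperplane exists even if the convex set has empty interior. -/
theorem exists_isMaxOn_of_notMem_interior [FiniteDimensional ℝ E] {Z : Set E} (hZ : Convex ℝ Z)
    {y : E} (hyZ : y ∈ Z) (hy : y ∉ interior Z) : ∃ f : E →L[ℝ] ℝ, f ≠ 0 ∧ IsMaxOn f Z y := by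
  by_cases hint : (interior Z).Nonempty
  · exact geometric_hahn_banach_of_nonempty_interior_point hZ hy hint
  · rw [hZ.interior_nonempty_iff_affineSpan_eq_top,
      ← AffineSubspace.direction_eq_top_iff_of_nonempty ⟨y, subset_affineSpan ℝ Z hyZ⟩] at hint
    obtain ⟨f, hf, hker⟩ := Submodule.exists_le_ker_of_lt_top _ (lt_top_iff_ne_top.2 hint)
    refine ⟨f.toContinuousLinearMap, by simpa using hf, fun a ha => ?_⟩
    have := hker (AffineSubspace.vsub_mem_direction (subset_affineSpan ℝ Z ha)
      (subset_affineSpan ℝ Z hyZ))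
    have : f a = f y := by simpa [sub_eq_zero] using this
    exact this.le

theorem notMem_interior_of_isMaxOn {Z : Set E} {f : E →L[ℝ] ℝ} (hf : f ≠ 0) {y : E}
    (hmax : IsMaxOn f Z y) : y ∉ interior Z := fun hy =>
  hf ((hmax.isLocalMax (mem_interior_iff_mem_nhds.1 hy)).hasFDerivAt_eq_zero f.hasFDerivAt)

variable [FiniteDimensional ℝ E] {Z V : Set E}

theorem eq_convexHull_of_exists_isMaxOn (hZ : Convex ℝ Z) (hV : IsCompact V) (hVne : V.Nonempty)
    (hVZ : V ⊆ Z) (hmax : ∀ f : E →L[ℝ] ℝ, f ≠ 0 → ∃ v ∈ V, IsMaxOn f Z v) :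
    Z = convexHull ℝ V := by
  refine Subset.antisymm (fun x hx => ?_) (convexHull_min hVZ hZ)
  by_contra hxV
  obtain ⟨f, c, hfV, hfx⟩ := geometric_hahn_banach_closed_point (convex_convexHull ℝ V)
    (isCompact_convexHull hV).isClosed hxV
  have hlt : ∀ v ∈ V, f v < f x := fun v hv => (hfV v (subset_convexHull ℝ V hv)).trans hfx
  have hf : f ≠ 0 := by
    rintro rfl
    simpa using hlt _ hVne.some_mem
  obtain ⟨v, hv, hvmax⟩ := hmax f hf
  exact (hlt v hv).not_ge (hvmax hx)

/-- The ray from the origin through `x` leaves `Z` at a point supported by some `f`; being a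
maximizer of `f`, that point belongs to `V`. -/
theorem exists_smul_mem_of_forall_isMaxOn_mem (hZ : Convex ℝ Z) (hZc : IsCompact Z)
    (hVne : V.Nonempty)
    (hmax : ∀ f : E →L[ℝ] ℝ, f ≠ 0 → ∀ y ∈ Z, IsMaxOn f Z y → y ∈ V) {x : E} (hx : x ∈ Z) :
    ∃ v ∈ V, ∃ r ∈ Icc (0 : ℝ) 1, x = r • v := by
  obtain rfl | hx0 := eq_or_ne x 0
  · exact ⟨hVne.some, hVne.some_mem, 0, by simp, by simp⟩
  have hcompact : IsCompact ((fun R : ℝ => R • x) ⁻¹' Z) :=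
    (isClosedEmbedding_smul_left hx0).isCompact_preimage hZc
  obtain ⟨R, hRZ, hR⟩ := hcompact.exists_isGreatest ⟨1, by simpa using hx⟩
  have hR1 : 1 ≤ R := hR (by simpa using hx)
  have hint : R • x ∉ interior Z := by
    intro h
    have : R ∈ interior ((fun R : ℝ => R • x) ⁻¹' Z) :=
      preimage_interior_subset_interior_preimage (by fun_prop) h
    have : R ∈ interior (Iic R) := interior_mono (fun S hS => hR hS) this
    simp at this
  obtain ⟨f, hf, hfmax⟩ := exists_isMaxOn_of_notMem_interior hZ hRZ hint
  refine ⟨R • x, hmax f hf _ hRZ hfmax, R⁻¹, ⟨by positivity, inv_le_one_of_one_le₀ hR1⟩, ?_⟩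
  rw [inv_smul_smul₀ (by positivity)]

end ConvexGeometry

section Zonoid

variable {α E : Type*} [MeasurableSpace α] {μ : Measure α}
  [NormedAddCommGroup E] [NormedSpace ℝ E] {g : α → E}

/-- The zonoid of the vector density `g`, i.e. the range of the vector measure `g μ` on functions
with values in `[-1, 1]`. Reach sets of linear control systems are translates of such sets. -/
def zonoid (μ : Measure α) (g : α → E) : Set E :=
  (fun w : α → ℝ => ∫ x, w x • g x ∂μ) '' {w | Measurable w ∧ ∀ x, |w x| ≤ 1}

theorem integrable_smul_of_abs_le_one (hg : Integrable g μ) {w : α → ℝ} (hw : Measurable w)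
    (hw1 : ∀ x, |w x| ≤ 1) : Integrable (fun x => w x • g x) μ :=
  hg.bdd_smul 1 hw.aestronglyMeasurable (.of_forall hw1)

theorem mul_le_abs_of_abs_le_one {a b : ℝ} (ha : |a| ≤ 1) : a * b ≤ |b| :=
  calc a * b ≤ |a| * |b| := (le_abs_self _).trans (abs_mul _ _).le
    _ ≤ |b| := mul_le_of_le_one_left (abs_nonneg _) ha

theorem convex_zonoid (hg : Integrable g μ) : Convex ℝ (zonoid μ g) := by
  rintro _ ⟨w, ⟨hw, hw1⟩, rfl⟩ _ ⟨v, ⟨hv, hv1⟩, rfl⟩ a b ha hb hab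
  refine ⟨fun x => a * w x + b * v x, ⟨by fun_prop, fun x => ?_⟩, ?_⟩
  · have := convex_Icc (-1 : ℝ) 1 (abs_le.1 (hw1 x)) (abs_le.1 (hv1 x)) ha hb hab
    exact abs_le.2 this
  · have hwint := (integrable_smul_of_abs_le_one hg hw hw1).fun_smul a
    have hvint := (integrable_smul_of_abs_le_one hg hv hv1).fun_smul b
    simp only [add_smul, mul_smul, integral_add hwint hvint, integral_smul]

variable [CompleteSpace E] {f : E →L[ℝ] ℝ} {β : α → ℝ}

theorem map_integral_smul (hg : Integrable g μ) {w : α → ℝ} (hw : Measurable w)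
    (hw1 : ∀ x, |w x| ≤ 1) : f (∫ x, w x • g x ∂μ) = ∫ x, w x * f (g x) ∂μ := by
  simp [← f.integral_comp_comm (integrable_smul_of_abs_le_one hg hw hw1)]

theorem le_integral_abs_of_mem_zonoid (hg : Integrable g μ) {y : E} (hy : y ∈ zonoid μ g) :
    f y ≤ ∫ x, |f (g x)| ∂μ := by
  obtain ⟨w, ⟨hw, hw1⟩, rfl⟩ := hy
  simp only [map_integral_smul hg hw hw1]
  exact integral_mono (integrable_smul_of_abs_le_one (f.integrable_comp hg) hw hw1)
    (f.integrable_comp hg).abs fun x => mul_le_abs_of_abs_le_one (hw1 x)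

theorem map_integral_smul_of_mul_eq_abs (hg : Integrable g μ) (hβ : Measurable β)
    (hβ1 : ∀ x, |β x| ≤ 1) (hfβ : ∀ᵐ x ∂μ, β x * f (g x) = |f (g x)|) :
    f (∫ x, β x • g x ∂μ) = ∫ x, |f (g x)| ∂μ := by
  rw [map_integral_smul hg hβ hβ1, integral_congr_ae hfβ]

theorem isMaxOn_zonoid_of_mul_eq_abs (hg : Integrable g μ) (hβ : Measurable β)
    (hβ1 : ∀ x, |β x| ≤ 1) (hfβ : ∀ᵐ x ∂μ, β x * f (g x) = |f (g x)|) :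
    IsMaxOn f (zonoid μ g) (∫ x, β x • g x ∂μ) := fun y hy => by
  simpa [map_integral_smul_of_mul_eq_abs hg hβ hβ1 hfβ] using le_integral_abs_of_mem_zonoid hg hy

/-- The weight of a maximizer has the sign of `f ∘ g` wherever `f ∘ g` does not vanish. -/
theorem eq_integral_smul_of_isMaxOn_zonoid (hg : Integrable g μ) (hβ : Measurable β)
    (hβ1 : ∀ x, |β x| ≤ 1) (hfβ : ∀ᵐ x ∂μ, β x * f (g x) = |f (g x)|)
    (hfg : ∀ᵐ x ∂μ, f (g x) = 0 → g x = 0) {y : E} (hy : y ∈ zonoid μ g)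
    (hmax : IsMaxOn f (zonoid μ g) y) : y = ∫ x, β x • g x ∂μ := by
  have hfy : ∫ x, |f (g x)| ∂μ ≤ f y := by
    rw [← map_integral_smul_of_mul_eq_abs hg hβ hβ1 hfβ]
    exact hmax ⟨β, ⟨hβ, hβ1⟩, rfl⟩
  obtain ⟨w, ⟨hw, hw1⟩, rfl⟩ := hy
  have hint : Integrable (fun x => w x * f (g x)) μ :=
    integrable_smul_of_abs_le_one (f.integrable_comp hg) hw hw1
  have hle : ∀ x, w x * f (g x) ≤ |f (g x)| := fun x => mul_le_abs_of_abs_le_one (hw1 x)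
  have hzero : ∫ x, |f (g x)| - w x * f (g x) ∂μ = 0 := by
    refine le_antisymm ?_ (integral_nonneg fun x => sub_nonneg.2 (hle x))
    rw [integral_sub (f.integrable_comp hg).abs hint, ← map_integral_smul hg hw hw1]
    exact sub_nonpos.2 hfy
  rw [integral_eq_zero_iff_of_nonneg (fun x => sub_nonneg.2 (hle x))
    ((f.integrable_comp hg).abs.sub hint)] at hzero
  refine integral_congr_ae ?_
  filter_upwards [hzero, hfβ, hfg] with x hwx hβx hfgx
  obtain hfx | hfx := eq_or_ne (f (g x)) 0
  · simp [hfgx hfx]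
  · have hwβ : w x * f (g x) = β x * f (g x) := by rw [hβx, ← sub_eq_zero.1 hwx]
    rw [mul_right_cancel₀ hfx hwβ]

end Zonoid

section Density

variable {α E : Type*} [TopologicalSpace α] [TopologicalSpace.PseudoMetrizableSpace α]
  [MeasurableSpace α] [BorelSpace α] {μ : Measure α} [NormedAddCommGroup E] [NormedSpace ℝ E]
  {g : α → E}

/-- Approximate `w` in `L¹` of the measure `‖g‖ μ`, then clip the approximation to `[-1, 1]`. -/
theorem zonoid_subset_closure_continuous (hg : Integrable g μ) :
    zonoid μ g ⊆
      closure ((fun v : α → ℝ => ∫ x, v x • g x ∂μ) '' {v | Continuous v ∧ ∀ x, |v x| ≤ 1}) := by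
  rintro _ ⟨w, ⟨hw, hw1⟩, rfl⟩
  refine Metric.mem_closure_iff.2 fun ε hε => ?_
  let ρ : Measure α := μ.withDensity fun x => ‖g x‖ₑ
  have : IsFiniteMeasure ρ := isFiniteMeasure_withDensity hg.2.ne
  have hwρ : Integrable w ρ := .of_bound hw.aestronglyMeasurable 1 (.of_forall hw1)
  obtain ⟨v, hv, hvint⟩ := hwρ.exists_boundedContinuous_integral_sub_le (half_pos hε)
  let clip : ℝ → ℝ := fun r => projIcc (-1 : ℝ) 1 (by norm_num) r
  have hclip : Continuous clip := continuous_subtype_val.comp continuous_projIcc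
  have hclip1 : ∀ r, |clip r| ≤ 1 := fun r => abs_le.2 (projIcc (-1 : ℝ) 1 _ r).2
  have hclip_sub : ∀ x, |w x - clip (v x)| ≤ |w x - v x| := fun x => by
    have hwx : clip (w x) = w x := by simp [clip, projIcc_of_mem _ (abs_le.1 (hw1 x))]
    calc |w x - clip (v x)| = |clip (w x) - clip (v x)| := by rw [hwx]
      _ ≤ |w x - v x| := abs_projIcc_sub_projIcc _
  refine ⟨_, ⟨fun x => clip (v x), ⟨by fun_prop, fun x => hclip1 _⟩, rfl⟩, ?_⟩
  have hint := integrable_smul_of_abs_le_one hg hw hw1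
  have hint' := integrable_smul_of_abs_le_one hg (w := fun x => clip (v x))
    (by fun_prop) (fun x => hclip1 _)
  calc dist (∫ x, w x • g x ∂μ) (∫ x, clip (v x) • g x ∂μ)
      = ‖∫ x, (w x - clip (v x)) • g x ∂μ‖ := by
        simp only [dist_eq_norm, sub_smul, integral_sub hint hint']
    _ ≤ ∫ x, ‖g x‖ * |w x - clip (v x)| ∂μ := by
        refine (norm_integral_le_integral_norm _).trans_eq ?_
        simp only [norm_smul, Real.norm_eq_abs, mul_comm]
    _ = ∫ x, |w x - clip (v x)| ∂ρ := by
        rw [integral_withDensity_eq_integral_toReal_smul₀ hg.1.enorm (by simp)]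
        simp
    _ ≤ ∫ x, |w x - v x| ∂ρ := by
        have hclipint : Integrable (fun x => clip (v x)) ρ :=
          .of_bound (by fun_prop) 1 (.of_forall fun x => hclip1 _)
        exact integral_mono (hwρ.sub hclipint).abs (hwρ.sub hvint).abs hclip_sub
    _ ≤ ε / 2 := hv
    _ < ε := half_lt_self hε

end Density

section BangBang

variable {ι : Type*} [Fintype ι]

/-- The bang-bang control that starts at `1` and changes sign at each switching time `σ i`. -/
noncomputable def bangBang (σ : ι → ℝ) (s : ℝ) : ℝ :=
  ∏ i, if s < σ i then 1 else -1

theorem measurable_bangBang (σ : ι → ℝ) : Measurable (bangBang σ) :=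
  Finset.measurable_fun_prod _ fun _ _ =>
    Measurable.ite measurableSet_Iio measurable_const measurable_const

theorem abs_bangBang (σ : ι → ℝ) (s : ℝ) : |bangBang σ s| = 1 := by
  rw [bangBang, Finset.abs_prod]
  exact Finset.prod_eq_one fun i _ => by split_ifs <;> simp

theorem bangBang_comp_perm (σ : ι → ℝ) (e : Equiv.Perm ι) : bangBang (σ ∘ e) = bangBang σ :=
  funext fun s => Equiv.prod_comp e fun i => if s < σ i then (1 : ℝ) else -1

theorem bangBang_cons {m : ℕ} (r : ℝ) (σ : Fin m → ℝ) (s : ℝ) :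
    bangBang (Fin.cons r σ : Fin (m + 1) → ℝ) s = (if s < r then 1 else -1) * bangBang σ s := by
  simp [bangBang, Fin.prod_univ_succ]

theorem continuousAt_bangBang {σ : ι → ℝ} {s : ℝ} (hs : s ∉ range σ) :
    ContinuousAt (fun σ' : ι → ℝ => bangBang σ' s) σ := by
  refine tendsto_finsetProd _ fun i _ => ?_
  refine tendsto_const_nhds.congr' ?_
  obtain h | h := lt_or_gt_of_ne fun h : s = σ i => hs ⟨i, h.symm⟩
  · filter_upwards [(continuous_apply i).continuousAt.eventually_const_lt h] with σ' h'
    rw [if_pos h, if_pos h']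
  · filter_upwards [(continuous_apply i).continuousAt.eventually_lt_const h] with σ' h'
    rw [if_neg h.not_gt, if_neg h'.not_gt]

theorem continuous_integral_bangBang_smul {E : Type*} [NormedAddCommGroup E] [NormedSpace ℝ E]
    {μ : Measure ℝ} [NullSingletonClass μ] {g : ℝ → E} (hg : Integrable g μ) :
    Continuous fun σ : ι → ℝ => ∫ s, bangBang σ s • g s ∂μ := by
  refine continuous_iff_continuousAt.2 fun σ => continuousAt_of_dominated (.of_forall fun σ' =>
    (integrable_smul_of_abs_le_one hg (measurable_bangBang σ') fun s => (abs_bangBang σ' s).le).1)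
    (.of_forall fun σ' => .of_forall fun s => ?_) hg.norm ?_
  · rw [norm_smul, Real.norm_eq_abs, abs_bangBang, one_mul]
  · filter_upwards [measure_eq_zero_iff_ae_notMem.1 ((finite_range σ).measure_zero μ)] with s hs
    exact (continuousAt_bangBang hs).smul continuousAt_const

end BangBang

section Nodes

variable {m : ℕ} {t : ℝ} {σ : Fin m → ℝ}

theorem isCompact_weyl (m : ℕ) (t : ℝ) : IsCompact (weyl m t) := by
  have hweyl : weyl m t = (univ.pi fun _ => Icc 0 t) ∩ {σ | Monotone σ} := by
    ext; simp only [weyl, mem_inter_iff, mem_univ_pi, mem_ofPred_eq, and_comm]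
  rw [hweyl]
  exact (isCompact_univ_pi fun _ => isCompact_Icc).inter_right isClosed_monotone

theorem const_mem_weyl (ht : 0 ≤ t) : (fun _ => t) ∈ weyl m t :=
  ⟨monotone_const, fun _ => ⟨ht, le_rfl⟩⟩

theorem nodes_castSucc_succ (t : ℝ) (σ : Fin m → ℝ) (i : Fin m) :
    nodes t σ i.succ.castSucc = σ i := by
  rw [← Fin.succ_castSucc, nodes, Fin.cons_succ, Fin.snoc_castSucc]

theorem nodes_last (t : ℝ) (σ : Fin m → ℝ) : nodes t σ (Fin.last (m + 1)) = t := by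
  rw [← Fin.succ_last, nodes, Fin.cons_succ, Fin.snoc_last]

theorem monotone_nodes (ht : 0 ≤ t) (hσ : σ ∈ weyl m t) : Monotone (nodes t σ) := by
  have hsnoc : Monotone (Fin.snoc σ t : Fin (m + 1) → ℝ) := by
    intro i j hij
    induction j using Fin.lastCases with
    | last => induction i using Fin.lastCases with
      | last => rfl
      | cast i => simpa using (hσ.2 i).2
    | cast j => induction i using Fin.lastCases with
      | last => exact absurd hij (Fin.castSucc_lt_last j).not_ge
      | cast i => simpa using hσ.1 (by simpa using hij)
  refine monotone_vecCons.2 ⟨?_, hsnoc⟩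
  induction (0 : Fin (m + 1)) using Fin.lastCases with
  | last => simpa using ht
  | cast i => simpa using (hσ.2 i).1

theorem nodes_mem_Icc (ht : 0 ≤ t) (hσ : σ ∈ weyl m t) (i : Fin (m + 2)) :
    nodes t σ i ∈ Icc 0 t :=
  ⟨monotone_nodes ht hσ (Fin.zero_le i),
    (monotone_nodes ht hσ (Fin.le_last i)).trans_eq (nodes_last t σ)⟩

theorem bangBang_eq_neg_one_pow (ht : 0 ≤ t) (hσ : σ ∈ weyl m t) (k : Fin (m + 1)) {s : ℝ}
    (hs : s ∈ Ioo (nodes t σ k.castSucc) (nodes t σ k.succ)) :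
    bangBang σ s = (-1) ^ (k : ℕ) := by
  have hmono := monotone_nodes ht hσ
  have hfactor : ∀ i : Fin m,
      (if s < σ i then (1 : ℝ) else -1) = if (i : ℕ) < k then -1 else 1 := by
    intro i
    by_cases hik : (i : ℕ) < k
    · have hle : σ i ≤ nodes t σ k.castSucc := by
        rw [← nodes_castSucc_succ t σ i]
        exact hmono (Fin.le_def.2 (by simpa using hik))
      rw [if_pos hik, if_neg (hle.trans hs.1.le).not_gt]
    · have hle : nodes t σ k.succ ≤ σ i := by
        rw [← nodes_castSucc_succ t σ i]
        exact hmono (Fin.le_def.2 (by simpa using hik))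
      rw [if_neg hik, if_pos (hs.2.trans_le hle)]
  simp only [bangBang, hfactor, Finset.prod_ite, Finset.prod_const, one_pow, mul_one,
    Fin.card_filter_val_lt, min_eq_right (Nat.lt_succ_iff.1 k.isLt)]

variable {E : Type*} [NormedAddCommGroup E] [NormedSpace ℝ E] {g : ℝ → E}

theorem neg_one_pow_smul_integral_nodes (ht : 0 ≤ t) (hσ : σ ∈ weyl m t) (k : Fin (m + 1)) :
    (-1 : ℝ) ^ (k : ℕ) • ∫ s in (nodes t σ k.castSucc)..(nodes t σ k.succ), g s
      = ∫ s in (nodes t σ k.castSucc)..(nodes t σ k.succ), bangBang σ s • g s := by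
  have hle : nodes t σ k.castSucc ≤ nodes t σ k.succ := monotone_nodes ht hσ k.castSucc_le_succ
  rw [← intervalIntegral.integral_smul, intervalIntegral.integral_of_le hle,
    intervalIntegral.integral_of_le hle, integral_Ioc_eq_integral_Ioo,
    integral_Ioc_eq_integral_Ioo]
  refine setIntegral_congr_fun measurableSet_Ioo fun s hs => ?_
  simp only [bangBang_eq_neg_one_pow ht hσ k hs]

theorem sum_integral_nodes_eq_integral_bangBang_smul (ht : 0 ≤ t) (hσ : σ ∈ weyl m t)
    (hg : IntervalIntegrable g volume 0 t) :
    ∑ k : Fin (m + 1), (-1 : ℝ) ^ (k : ℕ) •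
      ∫ s in (nodes t σ k.castSucc)..(nodes t σ k.succ), g s
      = ∫ s in (0 : ℝ)..t, bangBang σ s • g s := by
  have hint : IntervalIntegrable (fun s => bangBang σ s • g s) volume 0 t := by
    rw [intervalIntegrable_iff] at hg ⊢
    exact integrable_smul_of_abs_le_one hg (measurable_bangBang σ) fun s => (abs_bangBang σ s).le
  let a : ℕ → ℝ := fun k => nodes t σ (Fin.ofNat (m + 2) k)
  have hcast : ∀ k : Fin (m + 1), a k = nodes t σ k.castSucc := fun k =>
    congrArg (nodes t σ) (Fin.ext (by simp [Fin.ofNat]))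
  have hsucc : ∀ k : Fin (m + 1), a (k + 1) = nodes t σ k.succ := fun k =>
    congrArg (nodes t σ) (Fin.ext (by simp [Fin.ofNat, Nat.lt_succ_iff.1 k.isLt]))
  have hlast : a (m + 1) = t := (hsucc (Fin.last m)).trans (nodes_last t σ)
  have hsum := intervalIntegral.sum_integral_adjacent_intervals (a := a) (n := m + 1)
    (f := fun s => bangBang σ s • g s) (μ := volume) fun k _ => hint.mono_set <| by
      rw [uIcc_of_le ht]
      exact uIcc_subset_Icc (nodes_mem_Icc ht hσ _) (nodes_mem_Icc ht hσ _)
  rw [Finset.sum_range, hlast] at hsum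
  simp only [hcast, hsucc] at hsum
  exact (Finset.sum_congr rfl fun k _ => neg_one_pow_smul_integral_nodes ht hσ k).trans hsum

end Nodes

section Signs

open Polynomial

theorem exists_mul_eval_nonneg_of_forall_not_isRoot {p : ℝ[X]} (hp : ∀ r, ¬ p.IsRoot r) :
    ∃ ε ∈ ({1, -1} : Set ℝ), ∀ s, 0 ≤ ε * p.eval s := by
  have hsign : (∀ s, 0 ≤ p.eval s) ∨ ∀ s, p.eval s ≤ 0 := by
    by_contra! hcon
    obtain ⟨⟨a, ha⟩, b, hb⟩ := hcon
    obtain ⟨r, hr⟩ := mem_range_of_exists_le_of_exists_ge p.continuous ⟨a, ha.le⟩ ⟨b, hb.le⟩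
    exact hp r hr
  obtain h | h := hsign
  · exact ⟨1, by simp, by simpa using h⟩
  · exact ⟨-1, by simp, by simpa using h⟩

/-- The switching times are the roots of `p`, clipped to `[0, t]`. -/
theorem exists_bangBang_mul_eval_nonneg {t : ℝ} (ht : 0 ≤ t) {p : ℝ[X]} (hp : p ≠ 0) {m : ℕ}
    (hdeg : p.natDegree ≤ m) : ∃ σ : Fin m → ℝ, (∀ i, σ i ∈ Icc 0 t) ∧
      ∃ ε ∈ ({1, -1} : Set ℝ), ∀ s ∈ Ioo 0 t, 0 ≤ ε * bangBang σ s * p.eval s := by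
  induction m generalizing p with
  | zero =>
    obtain ⟨ε, hε, hεp⟩ := exists_mul_eval_nonneg_of_forall_not_isRoot fun r hr =>
      (natDegree_pos_iff_degree_pos.2 (degree_pos_of_root hp hr)).not_ge hdeg
    exact ⟨Fin.elim0, fun i => i.elim0, ε, hε, fun s _ => by simpa [bangBang] using hεp s⟩
  | succ m ih =>
    by_cases hroot : ∀ r, ¬ p.IsRoot r
    · obtain ⟨ε, hε, hεp⟩ := exists_mul_eval_nonneg_of_forall_not_isRoot hroot
      refine ⟨fun _ => t, fun _ => ⟨ht, le_rfl⟩, ε, hε, fun s hs => ?_⟩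
      simpa [bangBang, hs.2] using hεp s
    · push Not at hroot
      obtain ⟨r, hr⟩ := hroot
      obtain ⟨q, rfl⟩ := dvd_iff_isRoot.2 hr
      have hq : q ≠ 0 := right_ne_zero_of_mul hp
      rw [natDegree_mul (X_sub_C_ne_zero r) hq, natDegree_X_sub_C, add_comm] at hdeg
      obtain ⟨σ, hσ, ε, hε, hεq⟩ := ih hq (Nat.add_le_add_iff_right.1 hdeg)
      let clip : ℝ := max 0 (min t r)
      refine ⟨Fin.cons clip σ, Fin.forall_fin_succ.2 ⟨by simp [clip, ht], hσ⟩, -ε, ?_,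
        fun s hs => ?_⟩
      · obtain rfl | rfl := hε <;> simp
      · have hclip : s < clip ↔ s < r := by simp [clip, hs.1.not_gt, hs.2]
        have hfactor : 0 ≤ (r - s) * (if s < r then 1 else -1) := by
          split_ifs <;> linarith
        rw [bangBang_cons, if_congr hclip rfl rfl, eval_mul, eval_sub, eval_X, eval_C]
        linear_combination mul_nonneg (hεq s hs) hfactor

theorem exists_weyl_bangBang_mul_eval_nonneg {m : ℕ} {t : ℝ} (ht : 0 ≤ t) {p : ℝ[X]} (hp : p ≠ 0)
    (hdeg : p.natDegree ≤ m) : ∃ σ ∈ weyl m t, ∃ ε ∈ ({1, -1} : Set ℝ),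
      ∀ s ∈ Ioo 0 t, 0 ≤ ε * bangBang σ s * p.eval s := by
  obtain ⟨σ, hσ, h⟩ := exists_bangBang_mul_eval_nonneg ht hp hdeg
  exact ⟨σ ∘ Tuple.sort σ, ⟨Tuple.monotone_sort σ, fun _ => hσ _⟩, by rwa [bangBang_comp_perm]⟩

theorem exists_polynomial_bangBang_mul_eval_nonneg {m : ℕ} (σ : Fin m → ℝ) :
    ∃ p : ℝ[X], p ≠ 0 ∧ p.natDegree ≤ m ∧ ∀ s, 0 ≤ bangBang σ s * p.eval s := by
  have hdeg : ∀ i, (C (σ i) - X).natDegree = 1 := fun i => by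
    rw [← neg_sub, natDegree_neg, natDegree_X_sub_C]
  refine ⟨∏ i, (C (σ i) - X), Finset.prod_ne_zero_iff.2 fun i _ => ?_, ?_, fun s => ?_⟩
  · exact ne_zero_of_natDegree_gt (n := 0) (by rw [hdeg]; exact one_pos)
  · exact (natDegree_prod_le _ _).trans (by simp [hdeg])
  · rw [eval_prod, bangBang, ← Finset.prod_mul_distrib]
    refine Finset.prod_nonneg fun i _ => ?_
    simp only [eval_sub, eval_C, eval_X]
    split_ifs <;> linarith

theorem natDegree_comp_C_sub_X (p : ℝ[X]) (t : ℝ) : (p.comp (C t - X)).natDegree = p.natDegree := by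
  rw [natDegree_comp, ← neg_sub, natDegree_neg, natDegree_X_sub_C, mul_one]

theorem exists_polynomial_eval_eq_map_xi {m : ℕ} (t : ℝ) {f : (Fin (m + 1) → ℝ) →L[ℝ] ℝ}
    (hf : f ≠ 0) : ∃ p : ℝ[X], p ≠ 0 ∧ p.natDegree ≤ m ∧ ∀ s, p.eval s = f (xi m (t - s)) := by
  let v : Fin (m + 1) → ℝ := fun i => f (Pi.single i.rev 1) / (i : ℕ)!
  let q : ℝ[X] := ofFn (m + 1) v
  have hq : ∀ r, q.eval r = f (xi m r) := fun r => by
    rw [pi_eq_sum_univ' (xi m r), map_sum, ← Equiv.sum_comp Fin.revPerm]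
    simp only [q, v, ofFn_eq_sum_monomial, eval_finsetSum, eval_monomial, map_smul, xi, smul_eq_mul,
      Fin.revPerm_apply, Fin.val_rev]
    refine Finset.sum_congr rfl fun i _ => ?_
    rw [show m - (m + 1 - ((i : ℕ) + 1)) = i by omega]
    ring
  have hq0 : q ≠ 0 := by
    intro h
    have hv : v = 0 := injective_ofFn _ (h.trans (ofFn_zero _).symm)
    have hbasis : ∀ i, f (Pi.single i 1) = 0 := fun i => by
      simpa [v, Nat.factorial_ne_zero] using congrFun hv i.rev
    exact hf (ContinuousLinearMap.coe_injective <| LinearMap.pi_ext' fun i =>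
      LinearMap.ext_ring (hbasis i))
  refine ⟨q.comp (C t - X), fun h => hq0 ?_, ?_, fun s => by simp [hq]⟩
  · refine Polynomial.funext fun r => ?_
    simpa using congrArg (eval (t - r)) h
  · rw [natDegree_comp_C_sub_X]
    exact Nat.lt_succ_iff.1 (ofFn_natDegree_lt (by simp) _)

theorem exists_functional_map_xi_eq_eval {m : ℕ} (t : ℝ) {p : ℝ[X]} (hp : p ≠ 0)
    (hdeg : p.natDegree ≤ m) :
    ∃ f : (Fin (m + 1) → ℝ) →L[ℝ] ℝ, f ≠ 0 ∧ ∀ s, f (xi m (t - s)) = p.eval s := by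
  let q : ℝ[X] := p.comp (C t - X)
  have hq : q.natDegree < m + 1 := by
    rw [natDegree_comp_C_sub_X]
    exact Nat.lt_succ_iff.2 hdeg
  let f : (Fin (m + 1) → ℝ) →L[ℝ] ℝ :=
    ∑ k : Fin (m + 1), ((m - (k : ℕ))! * q.coeff (m - k)) • ContinuousLinearMap.proj k
  have hf : ∀ s, f (xi m (t - s)) = p.eval s := fun s => by
    calc f (xi m (t - s)) = ∑ k : Fin (m + 1), q.coeff (m - k) * (t - s) ^ (m - (k : ℕ)) := by
          simp only [f, sum_apply, smul_apply, ContinuousLinearMap.proj_apply, xi, smul_eq_mul]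
          refine Finset.sum_congr rfl fun k _ => ?_
          field_simp
      _ = q.eval (t - s) := by
          rw [eval_eq_sum_range' hq, ← Finset.sum_range_reflect, Finset.sum_range]
          simp only [Nat.add_sub_cancel]
      _ = p.eval s := by simp [q]
  refine ⟨f, fun h0 => hp (Polynomial.funext fun s => ?_), hf⟩
  simp [← hf, h0]

end Signs

section VariationOfConstants

theorem integral_deriv_mul_add_mul_of_eq_add_integral {a b : ℝ} {p p' y g : ℝ → ℝ}
    (hp : ∀ s, HasDerivAt p (p' s) s) (hp' : Continuous p') (hg : IntervalIntegrable g volume a b)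
    (hy : ∀ s ∈ uIcc a b, y s = y a + ∫ τ in a..s, g τ) :
    ∫ s in a..b, (p' s * y s + p s * g s) = p b * y b - p a * y a := by
  let Y : ℝ → ℝ := fun s => y a + ∫ τ in a..s, g τ
  have hYac : AbsolutelyContinuousOnInterval Y a b :=
    contDiffOn_const.absolutelyContinuousOnInterval.fun_add
      (hg.absolutelyContinuousOnInterval_intervalIntegral left_mem_uIcc)
  have hpac : AbsolutelyContinuousOnInterval p a b := by
    refine ContDiffOn.absolutelyContinuousOnInterval (ContDiff.contDiffOn ?_)
    exact contDiff_one_iff_deriv.2 ⟨fun s => (hp s).differentiableAt,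
      by rwa [funext fun s => (hp s).deriv]⟩
  have hYa : Y a = y a := (hy a left_mem_uIcc).symm
  have hYb : Y b = y b := (hy b right_mem_uIcc).symm
  rw [← hYa, ← hYb, ← hpac.integral_deriv_mul_eq_sub hYac]
  refine intervalIntegral.integral_congr_ae ?_
  filter_upwards [hg.ae_hasDerivAt_integral] with s hs hsab
  have hsab' := uIoc_subset_uIcc hsab
  have hYs : HasDerivAt Y (g s) s := (hs hsab' a left_mem_uIcc).const_add (y a)
  rw [(hp s).deriv, hYs.deriv, hy s hsab']

theorem intervalIntegral_apply {ι : Type*} [Fintype ι] {a b : ℝ} {g : ℝ → ι → ℝ}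
    (hg : IntervalIntegrable g volume a b) (i : ι) :
    (∫ s in a..b, g s) i = ∫ s in a..b, g s i :=
  ((ContinuousLinearMap.proj i : (ι → ℝ) →L[ℝ] ℝ).intervalIntegral_comp_comm hg).symm

theorem intervalIntegrable_apply {ι : Type*} [Fintype ι] {a b : ℝ} {g : ℝ → ι → ℝ}
    (hg : IntervalIntegrable g volume a b) (i : ι) :
    IntervalIntegrable (fun s => g s i) volume a b :=
  ⟨hg.1.eval i, hg.2.eval i⟩

/-- Differentiating `⟨ψ, x⟩` cancels the state matrix and leaves only the input. -/
theorem dotProduct_eq_add_integral_of_adjoint {ι : Type*} [Fintype ι] {A : Matrix ι ι ℝ}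
    {b : ι → ℝ} {t : ℝ} {u : ℝ → ℝ} {x ψ : ℝ → ι → ℝ} (hu : IntervalIntegrable u volume 0 t)
    (hxc : ContinuousOn x (uIcc 0 t))
    (hx : ∀ s ∈ uIcc 0 t, x s = x 0 + ∫ τ in (0 : ℝ)..s, (A *ᵥ x τ + u τ • b))
    (hψ : ∀ s, HasDerivAt ψ (-(ψ s ᵥ* A)) s) :
    ψ t ⬝ᵥ x t = ψ 0 ⬝ᵥ x 0 + ∫ s in (0 : ℝ)..t, u s * (ψ s ⬝ᵥ b) := by
  have hψc : Continuous ψ := continuous_iff_continuousAt.2 fun s => (hψ s).continuousAt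
  have hFint : IntervalIntegrable (fun s => A *ᵥ x s + u s • b) volume 0 t :=
    (A.mulVecLin.continuous_of_finiteDimensional.comp_continuousOn hxc).intervalIntegrable.add
      (hu.smul_continuousOn continuousOn_const)
  have hparts : ∀ i,
      ∫ s in (0 : ℝ)..t, ((-(ψ s ᵥ* A)) i * x s i + ψ s i * (A *ᵥ x s + u s • b) i) =
      ψ t i * x t i - ψ 0 i * x 0 i := fun i => by
    refine integral_deriv_mul_add_mul_of_eq_add_integral (fun s => hasDerivAt_pi.1 (hψ s) i)
      ((continuous_apply i).comp (hψc.matrix_vecMul continuous_const).neg)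
      (intervalIntegrable_apply hFint i) fun s hs => ?_
    rw [← intervalIntegral_apply (hFint.mono_set (uIcc_subset_uIcc_left hs)), ← Pi.add_apply,
      ← hx s hs]
  have hint : ∀ i ∈ Finset.univ, IntervalIntegrable
      (fun s => (-(ψ s ᵥ* A)) i * x s i + ψ s i * (A *ᵥ x s + u s • b) i) volume 0 t :=
      fun i _ => by
      refine ContinuousOn.intervalIntegrable ?_ |>.add
        ((intervalIntegrable_apply hFint i).continuousOn_mul (by fun_prop))
      exact (((continuous_apply i).comp (hψc.matrix_vecMul continuous_const).neg).continuousOn).mul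
        ((continuous_apply i).comp_continuousOn hxc)
  have hcancel : ∀ s, ∑ i, ((-(ψ s ᵥ* A)) i * x s i + ψ s i * (A *ᵥ x s + u s • b) i) =
      u s * (ψ s ⬝ᵥ b) := fun s => by
    calc _ = -(ψ s ᵥ* A) ⬝ᵥ x s + ψ s ⬝ᵥ (A *ᵥ x s + u s • b) := Finset.sum_add_distrib
      _ = u s * (ψ s ⬝ᵥ b) := by simp [dotProduct_add, Matrix.dotProduct_mulVec]
  calc ψ t ⬝ᵥ x t = ψ 0 ⬝ᵥ x 0 + ∑ i, (ψ t i * x t i - ψ 0 i * x 0 i) := by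
        simp [dotProduct, Finset.sum_sub_distrib]
    _ = ψ 0 ⬝ᵥ x 0 + ∫ s in (0 : ℝ)..t, u s * (ψ s ⬝ᵥ b) := by
        simp_rw [← hparts, ← intervalIntegral.integral_finsetSum hint, hcancel]

variable {m : ℕ}

theorem hasDerivAt_sub_pow_div_factorial (t s : ℝ) (j : ℕ) :
    HasDerivAt (fun r : ℝ => (t - r) ^ j / (j ! : ℝ))
      (-(if 0 < j then (t - s) ^ (j - 1) / ((j - 1)! : ℝ) else 0)) s := by
  obtain _ | j := j
  · simpa using hasDerivAt_const s (1 : ℝ)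
  · refine ((((hasDerivAt_id s).const_sub t).pow (j + 1)).div_const _).congr_deriv ?_
    have : (j ! : ℝ) ≠ 0 := by positivity
    simp only [Nat.factorial_succ, Nat.cast_mul, id, Nat.add_sub_cancel, Nat.succ_pos, if_true]
    field_simp

/-- The `k`-th row of `exp ((t - s) Aint)`. -/
noncomputable def transitionRow (t : ℝ) (k : Fin (m + 1)) (s : ℝ) : Fin (m + 1) → ℝ :=
  fun l => if k ≤ l then (t - s) ^ ((l : ℕ) - k) / (((l : ℕ) - k)! : ℝ) else 0

theorem aint_mulVec_castSucc (x : Fin (m + 1) → ℝ) (i : Fin m) :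
    (Aint m *ᵥ x) i.castSucc = x i.succ := by
  rw [Matrix.mulVec, dotProduct, Finset.sum_eq_single i.succ]
  · simp [Aint]
  · intro j _ hj
    have : (i : ℕ) + 1 ≠ j := fun h => hj (Fin.ext h.symm)
    simp [Aint, this]
  · simp

theorem aint_mulVec_last (x : Fin (m + 1) → ℝ) : (Aint m *ᵥ x) (Fin.last m) = 0 := by
  rw [Matrix.mulVec, dotProduct]
  refine Finset.sum_eq_zero fun j _ => ?_
  have : m + 1 ≠ j := j.isLt.ne'
  simp [Aint, this]

theorem vecMul_aint_zero (x : Fin (m + 1) → ℝ) : (x ᵥ* Aint m) 0 = 0 := by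
  simp [Matrix.vecMul, dotProduct, Aint]

theorem vecMul_aint_succ (x : Fin (m + 1) → ℝ) (j : Fin m) :
    (x ᵥ* Aint m) j.succ = x j.castSucc := by
  rw [Matrix.vecMul, dotProduct, Finset.sum_eq_single j.castSucc]
  · simp [Aint]
  · intro i _ hi
    have : (i : ℕ) ≠ j := fun h => hi (Fin.ext h)
    simp [Aint, this]
  · simp

theorem dotProduct_bcon (x : Fin (m + 1) → ℝ) : x ⬝ᵥ bcon m = x (Fin.last m) := by
  simp [dotProduct, bcon]

theorem hasDerivAt_transitionRow (t : ℝ) (k : Fin (m + 1)) (s : ℝ) :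
    HasDerivAt (transitionRow t k) (-(transitionRow t k s ᵥ* Aint m)) s := by
  refine hasDerivAt_pi.2 fun l => ?_
  by_cases hkl : k ≤ l
  · simp only [transitionRow, hkl, if_true]
    refine (hasDerivAt_sub_pow_div_factorial t s _).congr_deriv (congrArg Neg.neg ?_)
    cases l using Fin.cases with
    | zero => simp [vecMul_aint_zero]
    | succ l =>
      have hpos : k ≤ l.castSucc ↔ 0 < (l : ℕ) + 1 - k := by
        rw [Fin.le_def, Fin.val_castSucc]
        omega
      have hsub : (l : ℕ) + 1 - k - 1 = l - k := by omega
      simp [vecMul_aint_succ, transitionRow, hpos, hsub]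
  · simp only [transitionRow, hkl, if_false]
    refine (hasDerivAt_const s 0).congr_deriv ?_
    cases l using Fin.cases with
    | zero => simp [vecMul_aint_zero]
    | succ l =>
      have : ¬ k ≤ l.castSucc := fun h => hkl (h.trans l.castSucc_lt_succ.le)
      simp [vecMul_aint_succ, transitionRow, this]

theorem transitionRow_self_dotProduct (t : ℝ) (k : Fin (m + 1)) (x : Fin (m + 1) → ℝ) :
    transitionRow t k t ⬝ᵥ x = x k := by
  rw [dotProduct, Finset.sum_eq_single k]
  · simp [transitionRow]
  · intro l _ hl
    by_cases hkl : k ≤ l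
    · have : (l : ℕ) - k ≠ 0 := Nat.sub_ne_zero_of_lt (Fin.lt_def.1 (lt_of_le_of_ne hkl hl.symm))
      simp [transitionRow, this]
    · simp [transitionRow, hkl]
  · simp

theorem transitionRow_zero_dotProduct (t : ℝ) (k : Fin (m + 1)) (x : Fin (m + 1) → ℝ) :
    transitionRow t k 0 ⬝ᵥ x = chi t x k := by
  simp [transitionRow, chi, dotProduct]

theorem transitionRow_dotProduct_bcon (t : ℝ) (k : Fin (m + 1)) (s : ℝ) :
    transitionRow t k s ⬝ᵥ bcon m = xi m (t - s) k := by
  simp [dotProduct_bcon, transitionRow, xi, Fin.le_last]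

theorem continuous_xi (m : ℕ) : Continuous (xi m) := by
  unfold xi
  fun_prop

variable {t : ℝ} {x₀ : Fin (m + 1) → ℝ} {u : ℝ → ℝ} {x : ℝ → Fin (m + 1) → ℝ}

theorem IsTrajectory.apply_eq (ht : 0 ≤ t) (hu : IntervalIntegrable u volume 0 t)
    (hx : IsTrajectory t x₀ u x) :
    x t = chi t x₀ + ∫ s in (0 : ℝ)..t, u s • xi m (t - s) := by
  obtain ⟨hxc, hx⟩ := hx
  have hx0 : x 0 = x₀ := by simpa using hx 0 ⟨le_rfl, ht⟩
  rw [← uIcc_of_le ht] at hxc hx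
  have hint : IntervalIntegrable (fun s => u s • xi m (t - s)) volume 0 t :=
    hu.smul_continuousOn ((continuous_xi m).comp (by fun_prop : Continuous (t - ·))).continuousOn
  ext k
  have hadj := dotProduct_eq_add_integral_of_adjoint hu hxc (by simpa [hx0] using hx)
    (hasDerivAt_transitionRow t k)
  rw [transitionRow_self_dotProduct, hx0, transitionRow_zero_dotProduct] at hadj
  simp only [hadj, Pi.add_apply, intervalIntegral_apply hint, transitionRow_dotProduct_bcon,
    Pi.smul_apply, smul_eq_mul]

theorem aint_mulVec_add_smul_bcon_castSucc (x : Fin (m + 1) → ℝ) (c : ℝ) (i : Fin m) :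
    (Aint m *ᵥ x + c • bcon m) i.castSucc = x i.succ := by
  simp [aint_mulVec_castSucc, bcon, i.castSucc_lt_last.ne]

theorem aint_mulVec_add_smul_bcon_last (x : Fin (m + 1) → ℝ) (c : ℝ) :
    (Aint m *ᵥ x + c • bcon m) (Fin.last m) = c := by
  simp [aint_mulVec_last, bcon]

theorem exists_integrator_chain (hu : ∀ a b, IntervalIntegrable u volume a b)
    (x₀ : Fin (m + 1) → ℝ) :
    ∃ x : ℝ → Fin (m + 1) → ℝ, Continuous x ∧
      (∀ i : Fin m, ∀ s, x s i.castSucc = x₀ i.castSucc + ∫ τ in (0 : ℝ)..s, x τ i.succ) ∧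
      ∀ s, x s (Fin.last m) = x₀ (Fin.last m) + ∫ τ in (0 : ℝ)..s, u τ := by
  induction m with
  | zero =>
    refine ⟨fun s _ => x₀ 0 + ∫ τ in (0 : ℝ)..s, u τ, ?_, nofun, fun s => rfl⟩
    exact continuous_pi fun _ => continuous_const.add (intervalIntegral.continuous_primitive hu 0)
  | succ m ih =>
    obtain ⟨y, hyc, hy, hyl⟩ := ih (Fin.tail x₀)
    have hy0 : Continuous fun s => y s 0 := (continuous_apply 0).comp hyc
    refine ⟨fun s => Fin.cons (x₀ 0 + ∫ τ in (0 : ℝ)..s, y τ 0) (y s), ?_, ?_, hyl⟩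
    · exact (continuous_const.add (intervalIntegral.continuous_primitive
        hy0.intervalIntegrable 0)).finCons hyc
    · exact fun i => Fin.cases (fun s => rfl) hy i

theorem exists_isTrajectory (ht : 0 ≤ t) (hu : IntervalIntegrable u volume 0 t)
    (x₀ : Fin (m + 1) → ℝ) : ∃ x, IsTrajectory t x₀ u x := by
  have hu' : Integrable ((Ioc 0 t).indicator u) :=
    hu.1.integrable_indicator measurableSet_Ioc
  obtain ⟨x, hxc, hx, hxl⟩ := exists_integrator_chain (fun a b => hu'.intervalIntegrable) x₀
  refine ⟨x, hxc.continuousOn, fun s hs => funext fun i => ?_⟩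
  have hus : IntervalIntegrable u volume 0 s := hu.mono_set <| by
    rw [uIcc_of_le hs.1, uIcc_of_le ht]
    exact Icc_subset_Icc le_rfl hs.2
  have hint : IntervalIntegrable (fun τ => Aint m *ᵥ x τ + u τ • bcon m) volume 0 s :=
    ((Aint m).mulVecLin.continuous_of_finiteDimensional.comp hxc).intervalIntegrable 0 s |>.add
      (hus.smul_continuousOn continuousOn_const)
  rw [Pi.add_apply, intervalIntegral_apply hint]
  cases i using Fin.lastCases with
  | last =>
    simp only [aint_mulVec_add_smul_bcon_last, hxl]
    congr 1
    exact intervalIntegral.integral_congr_Ioo_of_le hs.1 fun τ hτ =>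
      indicator_of_mem (s := Ioc 0 t) ⟨hτ.1, hτ.2.le.trans hs.2⟩ u
  | cast i => simp only [aint_mulVec_add_smul_bcon_castSucc, hx]

theorem isClassicalTrajectory_iff_isTrajectory (ht : 0 ≤ t) (hu : ContinuousOn u (Icc 0 t)) :
    IsClassicalTrajectory t x₀ u x ↔ IsTrajectory t x₀ u x := by
  have hrhs (hxc : ContinuousOn x (Icc 0 t)) :
      ContinuousOn (fun τ => Aint m *ᵥ x τ + u τ • bcon m) (Icc 0 t) :=
    ((Aint m).mulVecLin.continuous_of_finiteDimensional.comp_continuousOn hxc).add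
      (hu.smul continuousOn_const)
  have hint (hxc : ContinuousOn x (Icc 0 t)) {s : ℝ} (hs : s ∈ Icc 0 t) :
      IntervalIntegrable (fun τ => Aint m *ᵥ x τ + u τ • bcon m) volume 0 s :=
    ((hrhs hxc).mono (Icc_subset_Icc le_rfl hs.2)).intervalIntegrable_of_Icc hs.1
  constructor
  · rintro ⟨h0, hd⟩
    have hxc : ContinuousOn x (Icc 0 t) := fun s hs => (hd s hs).continuousWithinAt
    refine ⟨hxc, fun s hs => ?_⟩
    have hsub : Icc 0 s ⊆ Icc 0 t := Icc_subset_Icc le_rfl hs.2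
    rw [intervalIntegral.integral_eq_sub_of_hasDerivAt_of_le hs.1 (hxc.mono hsub)
      (fun τ hτ => (hd τ (hsub (Ioo_subset_Icc_self hτ))).hasDerivAt
        (Icc_mem_nhds hτ.1 (hτ.2.trans_le hs.2))) (hint hxc hs), h0, add_sub_cancel]
  · rintro ⟨hxc, hx⟩
    refine ⟨by simpa using hx 0 ⟨le_rfl, ht⟩, fun s hs => ?_⟩
    have : Fact (s ∈ Icc 0 t) := ⟨hs⟩
    refine ((intervalIntegral.integral_hasDerivWithinAt_right (hint hxc hs)
      ((hrhs hxc).stronglyMeasurableAtFilter_nhdsWithin measurableSet_Icc s)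
      (hrhs hxc s hs)).const_add x₀).congr hx (hx s hs)

end VariationOfConstants

section Endpoint

variable {m : ℕ} {t : ℝ} {x₀ : Fin (m + 1) → ℝ} {u v umin umax : ℝ → ℝ}

/-- The state reached at time `t` from `x₀` with the input `u`, by variation of constants. -/
noncomputable def endpoint (t : ℝ) (x₀ : Fin (m + 1) → ℝ) (u : ℝ → ℝ) : Fin (m + 1) → ℝ :=
  chi t x₀ + ∫ s in (0 : ℝ)..t, u s • xi m (t - s)

theorem endpoint_congr (ht : 0 ≤ t) (huv : EqOn u v (Icc 0 t)) :
    endpoint t x₀ u = endpoint t x₀ v := by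
  rw [endpoint, intervalIntegral.integral_congr fun s hs => ?_, endpoint]
  rw [uIcc_of_le ht] at hs
  simp only [huv hs]

theorem measurable_indicator_of_continuousOn {f : ℝ → ℝ} {s : Set ℝ} (hs : MeasurableSet s)
    (hf : ContinuousOn f s) : Measurable (s.indicator f) := by
  classical
  rw [← piecewise_eq_indicator]
  exact hf.measurable_piecewise continuousOn_const hs

theorem IsContinuousRange.intervalIntegrable (hr : IsContinuousRange t umin umax) (ht : 0 ≤ t)
    (hu : Measurable u) (hub : ∀ s ∈ Icc 0 t, u s ∈ Icc (umin s) (umax s)) :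
    IntervalIntegrable u volume 0 t := by
  have hmem : ∀ᵐ s ∂volume.restrict (Ioc 0 t), u s ∈ Icc (umin s) (umax s) :=
    (ae_restrict_mem measurableSet_Ioc).mono fun s hs => hub s (Ioc_subset_Icc_self hs)
  rw [intervalIntegrable_iff_integrableOn_Ioc_of_le ht]
  exact integrable_of_le_of_le hu.aestronglyMeasurable (hmem.mono fun s hs => hs.1)
    (hmem.mono fun s hs => hs.2) (hr.1.integrableOn_Icc.mono_set Ioc_subset_Icc_self)
    (hr.2.1.integrableOn_Icc.mono_set Ioc_subset_Icc_self)

theorem reachSet_eq_image_endpoint (ht : 0 ≤ t) (hr : IsContinuousRange t umin umax) :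
    reachSet t x₀ umin umax =
      endpoint t x₀ '' {u | Measurable u ∧ ∀ s ∈ Icc 0 t, u s ∈ Icc (umin s) (umax s)} := by
  ext y
  constructor
  · rintro ⟨u, x, hu, hub, hx, rfl⟩
    exact ⟨u, ⟨hu, hub⟩, (hx.apply_eq ht (hr.intervalIntegrable ht hu hub)).symm⟩
  · rintro ⟨u, ⟨hu, hub⟩, rfl⟩
    have huint := hr.intervalIntegrable ht hu hub
    obtain ⟨x, hx⟩ := exists_isTrajectory ht huint x₀
    exact ⟨u, x, hu, hub, hx, hx.apply_eq ht huint⟩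

theorem contReachSet_eq_image_endpoint (ht : 0 ≤ t) :
    contReachSet t x₀ umin umax =
      endpoint t x₀ ''
        {u | ContinuousOn u (Icc 0 t) ∧ ∀ s ∈ Icc 0 t, u s ∈ Icc (umin s) (umax s)} := by
  ext y
  constructor
  · rintro ⟨u, x, hu, hub, hx, rfl⟩
    rw [isClassicalTrajectory_iff_isTrajectory ht hu] at hx
    exact ⟨u, ⟨hu, hub⟩, (hx.apply_eq ht (hu.intervalIntegrable_of_Icc ht)).symm⟩
  · rintro ⟨u, ⟨hu, hub⟩, rfl⟩
    have huint := hu.intervalIntegrable_of_Icc ht (μ := volume)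
    obtain ⟨x, hx⟩ := exists_isTrajectory ht huint x₀
    exact ⟨u, x, hu, hub, (isClassicalTrajectory_iff_isTrajectory ht hu).2 hx,
      hx.apply_eq ht huint⟩

theorem contReachSet_subset_reachSet (ht : 0 ≤ t) (hr : IsContinuousRange t umin umax) :
    contReachSet t x₀ umin umax ⊆ reachSet t x₀ umin umax := by
  rw [contReachSet_eq_image_endpoint ht, reachSet_eq_image_endpoint ht hr]
  rintro _ ⟨u, ⟨hu, hub⟩, rfl⟩
  refine ⟨(Icc 0 t).indicator u, ⟨measurable_indicator_of_continuousOn measurableSet_Icc hu,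
    fun s hs => ?_⟩, endpoint_congr ht fun s hs => indicator_of_mem hs u⟩
  rw [indicator_of_mem hs]
  exact hub s hs

end Endpoint

section Centering

variable {m : ℕ} {t : ℝ} {x₀ : Fin (m + 1) → ℝ} {umin umax : ℝ → ℝ}

/-- The density `μ(s) ξ(t - s)` through which the normalized input `(u - ν) / μ` displaces the
state at time `t` from the center `η_t`. -/
noncomputable def displacement (m : ℕ) (t : ℝ) (umin umax : ℝ → ℝ) (s : ℝ) : Fin (m + 1) → ℝ :=
  mu umin umax s • xi m (t - s)

/-- The reach set translated by `-η_t`, as the zonoid of the displacement density. -/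
abbrev centeredReachSet (m : ℕ) (t : ℝ) (umin umax : ℝ → ℝ) : Set (Fin (m + 1) → ℝ) :=
  zonoid (volume.restrict (Ioc 0 t)) (displacement m t umin umax)

theorem IsContinuousRange.continuousOn_mu (hr : IsContinuousRange t umin umax) :
    ContinuousOn (mu umin umax) (Icc 0 t) :=
  (hr.2.1.sub hr.1).div_const 2

theorem IsContinuousRange.continuousOn_nu (hr : IsContinuousRange t umin umax) :
    ContinuousOn (nu umin umax) (Icc 0 t) :=
  (hr.2.1.add hr.1).div_const 2

theorem IsContinuousRange.mu_nonneg (hr : IsContinuousRange t umin umax) {s : ℝ}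
    (hs : s ∈ Icc 0 t) : 0 ≤ mu umin umax s :=
  div_nonneg (sub_nonneg.2 (hr.2.2 s hs)) zero_le_two

theorem intervalIntegrable_smul_xi (ht : 0 ≤ t) {f : ℝ → ℝ} (hf : ContinuousOn f (Icc 0 t)) :
    IntervalIntegrable (fun s => f s • xi m (t - s)) volume 0 t :=
  ContinuousOn.intervalIntegrable_of_Icc ht
    (hf.smul ((continuous_xi m).comp (by fun_prop : Continuous (t - ·))).continuousOn)

theorem IsContinuousRange.integrable_displacement (hr : IsContinuousRange t umin umax)
    (ht : 0 ≤ t) : Integrable (displacement m t umin umax) (volume.restrict (Ioc 0 t)) :=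
  (intervalIntegrable_iff_integrableOn_Ioc_of_le ht).1
    (intervalIntegrable_smul_xi ht hr.continuousOn_mu)

theorem nu_add_mul_mu_mem_Icc {w s : ℝ} (hle : umin s ≤ umax s) (hw : |w| ≤ 1) :
    nu umin umax s + w * mu umin umax s ∈ Icc (umin s) (umax s) := by
  rw [abs_le] at hw
  unfold nu mu
  constructor <;> nlinarith

theorem abs_sub_nu_le_mu {c s : ℝ} (hc : c ∈ Icc (umin s) (umax s)) :
    |c - nu umin umax s| ≤ mu umin umax s := by
  unfold nu mu
  rw [abs_le]
  constructor <;> linarith [hc.1, hc.2]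

theorem endpoint_nu_add_mul_mu (ht : 0 ≤ t) (hr : IsContinuousRange t umin umax) {w : ℝ → ℝ}
    (hw : Measurable w) (hw1 : ∀ s, |w s| ≤ 1) :
    endpoint t x₀ (fun s => nu umin umax s + w s * mu umin umax s) = eta t x₀ umin umax +
      ∫ s, w s • displacement m t umin umax s ∂volume.restrict (Ioc 0 t) := by
  have hν := intervalIntegrable_smul_xi (m := m) ht hr.continuousOn_nu
  have hμ := integrable_smul_of_abs_le_one (hr.integrable_displacement (m := m) ht) hw hw1
  rw [eta, add_assoc, ← intervalIntegral.integral_of_le ht, ← intervalIntegral.integral_add hν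
    ((intervalIntegrable_iff_integrableOn_Ioc_of_le ht).2 hμ)]
  simp only [endpoint, displacement, add_smul, mul_smul]

theorem image_centeredReachSet_subset_reachSet (ht : 0 ≤ t) (hr : IsContinuousRange t umin umax) :
    (eta t x₀ umin umax + ·) '' centeredReachSet m t umin umax ⊆ reachSet t x₀ umin umax := by
  rw [reachSet_eq_image_endpoint ht hr]
  rintro _ ⟨_, ⟨w, ⟨hw, hw1⟩, rfl⟩, rfl⟩
  let u : ℝ → ℝ := fun s =>
    (Icc 0 t).indicator (nu umin umax) s + w s * (Icc 0 t).indicator (mu umin umax) s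
  have hu : EqOn u (fun s => nu umin umax s + w s * mu umin umax s) (Icc 0 t) := fun s hs => by
    simp only [u, indicator_of_mem hs]
  refine ⟨u, ⟨?_, fun s hs => ?_⟩, ?_⟩
  · exact (measurable_indicator_of_continuousOn measurableSet_Icc hr.continuousOn_nu).add
      (hw.mul (measurable_indicator_of_continuousOn measurableSet_Icc hr.continuousOn_mu))
  · rw [hu hs]
    exact nu_add_mul_mu_mem_Icc (hr.2.2 s hs) (hw1 s)
  · exact (endpoint_congr ht hu).trans (endpoint_nu_add_mul_mu ht hr hw hw1)

theorem reachSet_subset_image_centeredReachSet (ht : 0 ≤ t) (hr : IsContinuousRange t umin umax) :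
    reachSet t x₀ umin umax ⊆ (eta t x₀ umin umax + ·) '' centeredReachSet m t umin umax := by
  rw [reachSet_eq_image_endpoint ht hr]
  rintro _ ⟨u, ⟨hu, hub⟩, rfl⟩
  let w : ℝ → ℝ := fun s => (Icc 0 t).indicator (fun s => u s - nu umin umax s) s /
    (Icc 0 t).indicator (mu umin umax) s
  have hw : Measurable w := by
    refine Measurable.div ?_
      (measurable_indicator_of_continuousOn measurableSet_Icc hr.continuousOn_mu)
    simp only [indicator_sub]
    exact (hu.indicator measurableSet_Icc).sub
      (measurable_indicator_of_continuousOn measurableSet_Icc hr.continuousOn_nu)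
  have hw1 : ∀ s, |w s| ≤ 1 := fun s => by
    by_cases hs : s ∈ Icc 0 t
    · simp only [w, indicator_of_mem hs, abs_div, abs_of_nonneg (hr.mu_nonneg hs)]
      exact div_le_one_of_le₀ (abs_sub_nu_le_mu (hub s hs)) (hr.mu_nonneg hs)
    · simp [w, hs]
  have huw : EqOn (fun s => nu umin umax s + w s * mu umin umax s) u (Icc 0 t) := fun s hs => by
    have hsub : mu umin umax s = 0 → u s - nu umin umax s = 0 := fun h0 =>
      abs_nonpos_iff.1 ((abs_sub_nu_le_mu (hub s hs)).trans_eq h0)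
    simp only [w, indicator_of_mem hs, div_mul_cancel_of_imp hsub, add_sub_cancel]
  exact ⟨_, ⟨w, ⟨hw, hw1⟩, rfl⟩,
    (endpoint_nu_add_mul_mu ht hr hw hw1).symm.trans (endpoint_congr ht huw)⟩

theorem reachSet_eq_image_centeredReachSet (ht : 0 ≤ t) (hr : IsContinuousRange t umin umax) :
    reachSet t x₀ umin umax = (eta t x₀ umin umax + ·) '' centeredReachSet m t umin umax :=
  (reachSet_subset_image_centeredReachSet ht hr).antisymm
    (image_centeredReachSet_subset_reachSet ht hr)

theorem reachSet_subset_closure_contReachSet (ht : 0 ≤ t) (hr : IsContinuousRange t umin umax) :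
    reachSet t x₀ umin umax ⊆ closure (contReachSet t x₀ umin umax) := by
  rw [reachSet_eq_image_centeredReachSet ht hr, contReachSet_eq_image_endpoint ht]
  refine (image_mono (zonoid_subset_closure_continuous (hr.integrable_displacement ht))).trans
    ((image_closure_subset_closure_image (continuous_const_add _)).trans (closure_mono ?_))
  rintro _ ⟨_, ⟨w, ⟨hw, hw1⟩, rfl⟩, rfl⟩
  exact ⟨_, ⟨hr.continuousOn_nu.add (hw.continuousOn.mul hr.continuousOn_mu),
    fun s hs => nu_add_mul_mu_mem_Icc (hr.2.2 s hs) (hw1 s)⟩,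
    endpoint_nu_add_mul_mu ht hr hw.measurable hw1⟩

end Centering

section BoundaryStructure

variable {m : ℕ} {t : ℝ} {x₀ : Fin (m + 1) → ℝ} {umin umax : ℝ → ℝ} {σ : Fin m → ℝ}
  {f : (Fin (m + 1) → ℝ) →L[ℝ] ℝ}

theorem integral_mul_bangBang_smul_displacement (ht : 0 ≤ t) (hr : IsContinuousRange t umin umax)
    (hσ : σ ∈ weyl m t) (c : ℝ) :
    ∫ s, (c * bangBang σ s) • displacement m t umin umax s ∂volume.restrict (Ioc 0 t) =
      c • alternating t umin umax σ := by
  simp only [mul_smul, integral_smul]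
  rw [← intervalIntegral.integral_of_le ht, alternating]
  simp only [← sum_integral_nodes_eq_integral_bangBang_smul ht hσ
    (intervalIntegrable_smul_xi ht hr.continuousOn_mu), displacement]

theorem abs_mul_bangBang {ε : ℝ} (hε : ε ∈ ({1, -1} : Set ℝ)) (s : ℝ) :
    |ε * bangBang σ s| = 1 := by
  obtain rfl | rfl := hε <;> simp [abs_bangBang]

theorem mul_map_displacement_eq_abs {c s : ℝ} (hμ : 0 ≤ mu umin umax s) (hc : |c| = 1)
    (hcf : 0 ≤ c * f (xi m (t - s))) :
    c * f (displacement m t umin umax s) = |f (displacement m t umin umax s)| := by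
  have hnonneg : 0 ≤ c * f (displacement m t umin umax s) := by
    rw [displacement, map_smul, smul_eq_mul, mul_left_comm]
    exact mul_nonneg hμ hcf
  rw [← abs_of_nonneg hnonneg, abs_mul, hc, one_mul]

theorem ae_displacement_eq_zero_of_map_eq_zero (hf : f ≠ 0) :
    ∀ᵐ s, f (displacement m t umin umax s) = 0 → displacement m t umin umax s = 0 := by
  obtain ⟨p, hp, -, hpf⟩ := exists_polynomial_eval_eq_map_xi t hf
  have hroots : ∀ᵐ s : ℝ, ¬ p.IsRoot s :=
    measure_eq_zero_iff_ae_notMem.1 ((Polynomial.finite_setOfPred_isRoot hp).measure_zero volume)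
  filter_upwards [hroots] with s hs h0
  rw [displacement, map_smul, ← hpf, smul_eq_mul, mul_eq_zero] at h0
  rw [displacement, h0.resolve_right hs, zero_smul]

/-- The points `± (x^upper(σ) - η_t)` with `σ` in the Weyl chamber. -/
def signedAlternating (m : ℕ) (t : ℝ) (umin umax : ℝ → ℝ) : Set (Fin (m + 1) → ℝ) :=
  (fun p : ℝ × (Fin m → ℝ) => p.1 • alternating t umin umax p.2) '' ({1, -1} ×ˢ weyl m t)

theorem isCompact_signedAlternating (ht : 0 ≤ t) (hr : IsContinuousRange t umin umax) :
    IsCompact (signedAlternating m t umin umax) := by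
  have hcont : ContinuousOn (alternating t umin umax) (weyl m t) :=
    (continuous_integral_bangBang_smul (hr.integrable_displacement (m := m) ht)).continuousOn.congr
      fun σ hσ => by simpa using (integral_mul_bangBang_smul_displacement ht hr hσ 1).symm
  exact ((toFinite {1, -1}).isCompact.prod (isCompact_weyl m t)).image_of_continuousOn
    (continuousOn_fst.smul (hcont.comp continuousOn_snd fun p hp => hp.2))

theorem smul_alternating_mem_centeredReachSet (ht : 0 ≤ t) (hr : IsContinuousRange t umin umax)
    (hσ : σ ∈ weyl m t) {r : ℝ} (hr1 : |r| ≤ 1) :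
    r • alternating t umin umax σ ∈ centeredReachSet m t umin umax :=
  ⟨fun s => r * bangBang σ s, ⟨(measurable_bangBang σ).const_mul r, fun s => by
    rwa [abs_mul, abs_bangBang, mul_one]⟩, integral_mul_bangBang_smul_displacement ht hr hσ r⟩

theorem signedAlternating_subset_centeredReachSet (ht : 0 ≤ t)
    (hr : IsContinuousRange t umin umax) :
    signedAlternating m t umin umax ⊆ centeredReachSet m t umin umax := by
  rintro _ ⟨⟨ε, σ⟩, ⟨hε, hσ⟩, rfl⟩
  refine smul_alternating_mem_centeredReachSet ht hr hσ ?_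
  obtain rfl | rfl := hε <;> simp

theorem IsContinuousRange.ae_mu_nonneg (hr : IsContinuousRange t umin umax) :
    ∀ᵐ s ∂volume.restrict (Ioc 0 t), 0 ≤ mu umin umax s :=
  (ae_restrict_mem measurableSet_Ioc).mono fun _ hs => hr.mu_nonneg (Ioc_subset_Icc_self hs)

/-- `f (ξ(t - s))` is a polynomial in `s` of degree less than `n`, so its sign is that of a
bang-bang control with at most `n - 1` switchings. -/
theorem exists_bangBang_mul_map_displacement_eq_abs (ht : 0 ≤ t)
    (hr : IsContinuousRange t umin umax) (hf : f ≠ 0) :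
    ∃ σ ∈ weyl m t, ∃ ε ∈ ({1, -1} : Set ℝ), ∀ᵐ s ∂volume.restrict (Ioc 0 t),
      ε * bangBang σ s * f (displacement m t umin umax s) =
        |f (displacement m t umin umax s)| := by
  obtain ⟨p, hp, hdeg, hpf⟩ := exists_polynomial_eval_eq_map_xi t hf
  obtain ⟨σ, hσ, ε, hε, hsign⟩ := exists_weyl_bangBang_mul_eval_nonneg ht hp hdeg
  have hmem : ∀ᵐ s ∂volume.restrict (Ioc 0 t), s ∈ Ioo 0 t := by
    rw [← Measure.restrict_congr_set Ioo_ae_eq_Ioc]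
    exact ae_restrict_mem measurableSet_Ioo
  refine ⟨σ, hσ, ε, hε, ?_⟩
  filter_upwards [hmem, hr.ae_mu_nonneg] with s hs hμ
  exact mul_map_displacement_eq_abs hμ (abs_mul_bangBang hε s) (hpf s ▸ hsign s hs)

theorem exists_mem_signedAlternating_isMaxOn (ht : 0 ≤ t) (hr : IsContinuousRange t umin umax)
    (hf : f ≠ 0) :
    let Z := centeredReachSet m t umin umax
    ∃ v ∈ signedAlternating m t umin umax, IsMaxOn f Z v ∧ ∀ y ∈ Z, IsMaxOn f Z y → y = v := by
  intro Z
  obtain ⟨σ, hσ, ε, hε, hβ⟩ := exists_bangBang_mul_map_displacement_eq_abs ht hr hf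
  have hint := hr.integrable_displacement (m := m) ht
  have hmeas : Measurable fun s => ε * bangBang σ s := (measurable_bangBang σ).const_mul ε
  have hβ1 : ∀ s, |ε * bangBang σ s| ≤ 1 := fun s => (abs_mul_bangBang hε s).le
  refine ⟨_, ⟨(ε, σ), ⟨hε, hσ⟩, rfl⟩, ?_⟩
  simp only [← integral_mul_bangBang_smul_displacement ht hr hσ]
  exact ⟨isMaxOn_zonoid_of_mul_eq_abs hint hmeas hβ1 hβ, fun y hy hmax =>
    eq_integral_smul_of_isMaxOn_zonoid hint hmeas hβ1 hβ
      (ae_restrict_of_ae (ae_displacement_eq_zero_of_map_eq_zero hf)) hy hmax⟩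

theorem signedAlternating_nonempty (ht : 0 ≤ t) : (signedAlternating m t umin umax).Nonempty :=
  ⟨_, (1, fun _ => t), ⟨Or.inl rfl, const_mem_weyl ht⟩, rfl⟩

theorem isCompact_centeredReachSet (ht : 0 ≤ t) (hr : IsContinuousRange t umin umax) :
    IsCompact (centeredReachSet m t umin umax) := by
  rw [centeredReachSet, eq_convexHull_of_exists_isMaxOn
    (convex_zonoid (hr.integrable_displacement ht)) (isCompact_signedAlternating ht hr)
    (signedAlternating_nonempty ht) (signedAlternating_subset_centeredReachSet ht hr) fun f hf =>
      let ⟨v, hv, hmax, _⟩ := exists_mem_signedAlternating_isMaxOn ht hr hf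
      ⟨v, hv, hmax⟩]
  exact isCompact_convexHull (isCompact_signedAlternating ht hr)

theorem centeredReachSet_eq_image (ht : 0 ≤ t) (hr : IsContinuousRange t umin umax) :
    centeredReachSet m t umin umax =
      (fun p : (Fin m → ℝ) × ℝ => (2 * p.2 - 1) • alternating t umin umax p.1) ''
        (weyl m t ×ˢ Icc 0 1) := by
  refine Subset.antisymm (fun y hy => ?_) ?_
  · have hmax : ∀ f : (Fin (m + 1) → ℝ) →L[ℝ] ℝ, f ≠ 0 →
        ∀ z ∈ centeredReachSet m t umin umax, IsMaxOn f (centeredReachSet m t umin umax) z →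
          z ∈ signedAlternating m t umin umax := fun f hf z hz hzmax => by
      obtain ⟨v, hv, -, huniq⟩ := exists_mem_signedAlternating_isMaxOn ht hr hf
      exact huniq z hz hzmax ▸ hv
    obtain ⟨_, ⟨⟨ε, σ⟩, ⟨hε, hσ⟩, rfl⟩, r, hr1, rfl⟩ := exists_smul_mem_of_forall_isMaxOn_mem
      (convex_zonoid (hr.integrable_displacement ht)) (isCompact_centeredReachSet ht hr)
      (signedAlternating_nonempty ht) hmax hy
    refine ⟨(σ, (r * ε + 1) / 2), ⟨hσ, ?_⟩, ?_⟩
    · obtain rfl | rfl := hε <;> constructor <;> linarith [hr1.1, hr1.2]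
    · simp only [smul_smul, mul_div_cancel₀ _ (two_ne_zero' ℝ), add_sub_cancel_right]
  · rintro _ ⟨⟨σ, r⟩, ⟨hσ, hr1⟩, rfl⟩
    exact smul_alternating_mem_centeredReachSet ht hr hσ
      (abs_le.2 ⟨by linarith [hr1.1], by linarith [hr1.2]⟩)

theorem smul_alternating_notMem_interior_centeredReachSet (ht : 0 ≤ t)
    (hr : IsContinuousRange t umin umax) (hσ : σ ∈ weyl m t) {ε : ℝ} (hε : ε ∈ ({1, -1} : Set ℝ)) :
    ε • alternating t umin umax σ ∉ interior (centeredReachSet m t umin umax) := by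
  obtain ⟨p, hp, hdeg, hsign⟩ := exists_polynomial_bangBang_mul_eval_nonneg σ
  obtain ⟨f, hf, hfp⟩ := exists_functional_map_xi_eq_eval t hp hdeg
  have hε2 : ε * ε = 1 := by obtain rfl | rfl := hε <;> norm_num
  have hε0 : ε ≠ 0 := left_ne_zero_of_mul_eq_one hε2
  rw [← integral_mul_bangBang_smul_displacement ht hr hσ]
  refine notMem_interior_of_isMaxOn (smul_ne_zero hε0 hf) (isMaxOn_zonoid_of_mul_eq_abs
    (hr.integrable_displacement ht) ((measurable_bangBang σ).const_mul ε)
    (fun s => (abs_mul_bangBang hε s).le) ?_)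
  filter_upwards [hr.ae_mu_nonneg] with s hμ
  refine mul_map_displacement_eq_abs hμ (abs_mul_bangBang hε s) ?_
  rw [smul_apply, hfp, smul_eq_mul, mul_mul_mul_comm, hε2, one_mul]
  exact hsign s

theorem piMap_eq (p : (Fin m → ℝ) × ℝ) :
    piMap t x₀ umin umax p =
      eta t x₀ umin umax + (2 * p.2 - 1) • alternating t umin umax p.1 := by
  simp only [piMap, xUpper, xLower]
  module

theorem image_piMap_eq_reachSet (ht : 0 ≤ t) (hr : IsContinuousRange t umin umax) :
    piMap t x₀ umin umax '' (weyl m t ×ˢ Icc 0 1) = reachSet t x₀ umin umax := by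
  rw [reachSet_eq_image_centeredReachSet ht hr, centeredReachSet_eq_image ht hr, image_image]
  exact image_congr fun p _ => piMap_eq p

theorem closure_contReachSet (ht : 0 ≤ t) (hr : IsContinuousRange t umin umax) :
    closure (contReachSet t x₀ umin umax) = reachSet t x₀ umin umax := by
  have hclosed : IsClosed (reachSet t x₀ umin umax) := by
    rw [reachSet_eq_image_centeredReachSet ht hr]
    exact ((isCompact_centeredReachSet ht hr).image (continuous_const_add _)).isClosed
  exact (closure_minimal (contReachSet_subset_reachSet ht hr) hclosed).antisymm
    (reachSet_subset_closure_contReachSet ht hr)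

theorem eta_add_smul_alternating_mem_frontier (ht : 0 ≤ t) (hr : IsContinuousRange t umin umax)
    (hσ : σ ∈ weyl m t) {ε : ℝ} (hε : ε ∈ ({1, -1} : Set ℝ)) :
    eta t x₀ umin umax + ε • alternating t umin umax σ ∈
      frontier (reachSet t x₀ umin umax) ∩ frontier (contReachSet t x₀ umin umax) := by
  have hmem : eta t x₀ umin umax + ε • alternating t umin umax σ ∈ reachSet t x₀ umin umax := by
    rw [reachSet_eq_image_centeredReachSet ht hr]
    exact mem_image_of_mem _
      (signedAlternating_subset_centeredReachSet ht hr ⟨(ε, σ), ⟨hε, hσ⟩, rfl⟩)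
  have hint : eta t x₀ umin umax + ε • alternating t umin umax σ ∉
      interior (reachSet t x₀ umin umax) := by
    rw [reachSet_eq_image_centeredReachSet ht hr, ← Homeomorph.coe_addLeft,
      ← Homeomorph.image_interior, Homeomorph.coe_addLeft, (add_right_injective _).mem_set_image]
    exact smul_alternating_notMem_interior_centeredReachSet ht hr hσ hε
  exact ⟨⟨subset_closure hmem, hint⟩, (closure_contReachSet ht hr).symm ▸ hmem,
    fun h => hint (interior_mono (contReachSet_subset_reachSet ht hr) h)⟩

theorem xUpper_mem_frontier (ht : 0 ≤ t) (hr : IsContinuousRange t umin umax)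
    (hσ : σ ∈ weyl m t) : xUpper t x₀ umin umax σ ∈
      frontier (reachSet t x₀ umin umax) ∩ frontier (contReachSet t x₀ umin umax) := by
  simpa [xUpper] using
    eta_add_smul_alternating_mem_frontier (x₀ := x₀) ht hr hσ (mem_insert (1 : ℝ) _)

theorem xLower_mem_frontier (ht : 0 ≤ t) (hr : IsContinuousRange t umin umax)
    (hσ : σ ∈ weyl m t) : xLower t x₀ umin umax σ ∈
      frontier (reachSet t x₀ umin umax) ∩ frontier (contReachSet t x₀ umin umax) := by
  simpa [xLower, sub_eq_add_neg] using
    eta_add_smul_alternating_mem_frontier (x₀ := x₀) ht hr hσ (mem_insert_of_mem (1 : ℝ) rfl)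

end BoundaryStructure

section InducedRange

variable {f : ℝ → ℝ} {a b s : ℝ}

theorem isLUB_integral_smul_continuous {α : Type*} [TopologicalSpace α]
    [TopologicalSpace.PseudoMetrizableSpace α] [MeasurableSpace α] [BorelSpace α] {μ : Measure α}
    {g : α → ℝ} (hg : Integrable g μ) :
    IsLUB ((fun v : α → ℝ => ∫ x, v x • g x ∂μ) '' {v | Continuous v ∧ ∀ x, |v x| ≤ 1})
      (∫ x, |g x| ∂μ) := by
  refine isLUB_of_mem_closure ?_ (zonoid_subset_closure_continuous hg ?_)
  · rintro _ ⟨v, ⟨hv, hv1⟩, rfl⟩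
    exact le_integral_abs_of_mem_zonoid (f := .id ℝ ℝ) hg ⟨v, ⟨hv.measurable, hv1⟩, rfl⟩
  · let sgn : α → ℝ := fun x => if 0 ≤ hg.1.mk g x then 1 else -1
    have hsgn : Measurable sgn := Measurable.ite
      (measurableSet_le measurable_const hg.1.stronglyMeasurable_mk.measurable)
      measurable_const measurable_const
    refine ⟨sgn, ⟨hsgn, fun x => ?_⟩, integral_congr_ae ?_⟩
    · by_cases h : 0 ≤ hg.1.mk g x <;> simp [sgn, h]
    · filter_upwards [hg.1.ae_eq_mk] with x hx
      by_cases h : 0 ≤ hg.1.mk g x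
      · simp [sgn, hx, h, abs_of_nonneg]
      · simp [sgn, hx, h, abs_of_neg (not_le.1 h)]

/-- The functional `I_s` with an arbitrary kernel `f`. -/
noncomputable def inputFunctional (f : ℝ → ℝ) (s : ℝ) (v : ℝ → ℝ) : ℝ :=
  v s - ∫ τ in (0 : ℝ)..s, f τ * v τ

theorem inputFunctional_congr (hs : 0 ≤ s) {v w : ℝ → ℝ} (hvw : EqOn v w (Icc 0 s)) :
    inputFunctional f s v = inputFunctional f s w := by
  have hint : ∫ τ in (0 : ℝ)..s, f τ * v τ = ∫ τ in (0 : ℝ)..s, f τ * w τ :=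
    intervalIntegral.integral_congr fun τ hτ => by
      rw [uIcc_of_le hs] at hτ
      simp only [hvw hτ]
  rw [inputFunctional, inputFunctional, hvw ⟨hs, le_rfl⟩, hint]

theorem inputFunctional_const_add_mul (hf : Continuous f) {w : ℝ → ℝ} (hw : Continuous w)
    (c h : ℝ) :
    inputFunctional f s (fun τ => c + h * w τ) =
      c * (1 - ∫ τ in (0 : ℝ)..s, f τ) + h * inputFunctional f s w := by
  have hsplit : ∫ τ in (0 : ℝ)..s, f τ * (c + h * w τ) =
      c * (∫ τ in (0 : ℝ)..s, f τ) + h * ∫ τ in (0 : ℝ)..s, f τ * w τ := by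
    rw [← intervalIntegral.integral_const_mul, ← intervalIntegral.integral_const_mul,
      ← intervalIntegral.integral_add ((hf.const_mul c).intervalIntegrable 0 s)
        (((hf.fun_mul hw).const_mul h).intervalIntegrable 0 s)]
    congr 1 with τ
    ring
  rw [inputFunctional, inputFunctional, hsplit]
  ring

theorem integrable_restrict_add_dirac (hs : 0 ≤ s) {F G : ℝ → ℝ} (hG : Continuous G)
    (hFG : ∀ τ ≠ s, F τ = G τ) :
    Integrable F (volume.restrict (Ioc 0 s) + Measure.dirac s) ∧
      ∫ τ, F τ ∂(volume.restrict (Ioc 0 s) + Measure.dirac s) =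
        (∫ τ in (0 : ℝ)..s, G τ) + F s := by
  have hae : G =ᵐ[volume.restrict (Ioc 0 s)] F :=
    ae_restrict_of_ae ((measure_eq_zero_iff_ae_notMem.1 (measure_singleton s)).mono
      fun τ hτ => (hFG τ hτ).symm)
  have hF : Integrable F (volume.restrict (Ioc 0 s)) :=
    ((intervalIntegrable_iff_integrableOn_Ioc_of_le hs).1 (hG.intervalIntegrable 0 s)).congr hae
  have hdirac : Integrable F (Measure.dirac s) := integrable_dirac (by simp)
  refine ⟨hF.add_measure hdirac, ?_⟩
  rw [integral_add_measure hF hdirac, integral_dirac, ← integral_congr_ae hae,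
    intervalIntegral.integral_of_le hs]

/-- `I_s` is integration against the measure `δ_s - f dτ`, whose total variation is
`1 + ∫₀ˢ |f|`. -/
theorem isLUB_inputFunctional_continuous (hs : 0 ≤ s) (hf : Continuous f) :
    IsLUB (inputFunctional f s '' {w | Continuous w ∧ ∀ τ, |w τ| ≤ 1})
      ((∫ τ in (0 : ℝ)..s, |f τ|) + 1) := by
  let g : ℝ → ℝ := Function.update (fun τ => -f τ) s 1
  have hg : ∀ τ ≠ s, g τ = -f τ := fun τ hτ => Function.update_of_ne hτ _ _
  have hgs : g s = 1 := Function.update_self _ _ _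
  have hlub := isLUB_integral_smul_continuous (integrable_restrict_add_dirac hs hf.neg hg).1
  rw [(integrable_restrict_add_dirac (F := fun τ => |g τ|) hs hf.abs fun τ hτ => by
    rw [hg τ hτ, abs_neg]).2, hgs, abs_one] at hlub
  convert hlub using 1
  refine image_congr fun w hw => ?_
  rw [(integrable_restrict_add_dirac (F := fun τ => w τ • g τ) hs (hf.fun_mul hw.1).fun_neg
    fun τ hτ => by rw [hg τ hτ, smul_eq_mul, mul_neg, mul_comm]).2, hgs, inputFunctional,
    intervalIntegral.integral_neg, smul_eq_mul, mul_one, neg_add_eq_sub]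

theorem inputFunctional_image_contInputs (hs : 0 ≤ s) (hf : Continuous f) {h : ℝ}
    (hh : |h| = (b - a) / 2) :
    inputFunctional f s '' contInputs s a b =
      (fun y => (a + b) / 2 * (1 - ∫ τ in (0 : ℝ)..s, f τ) + h * y) ''
        (inputFunctional f s '' {w | Continuous w ∧ ∀ τ, |w τ| ≤ 1}) := by
  have hcenter : ∀ y : ℝ, y ∈ Icc a b ↔ |y - (a + b) / 2| ≤ |h| := fun y => by
    rw [hh, abs_le, mem_Icc]
    constructor <;> rintro ⟨h₁, h₂⟩ <;> constructor <;> linarith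
  rw [image_image]
  refine Subset.antisymm ?_ ?_
  · rintro _ ⟨v, ⟨hv, hvb⟩, rfl⟩
    have hmem : ∀ τ, |v (projIcc 0 s hs τ) - (a + b) / 2| ≤ |h| := fun τ =>
      (hcenter _).1 (hvb _ (projIcc 0 s hs τ).2)
    have hvc : Continuous fun τ => v (projIcc 0 s hs τ) :=
      hv.comp_continuous (continuous_subtype_val.comp continuous_projIcc)
        fun τ => (projIcc 0 s hs τ).2
    have hw : Continuous fun τ => (v (projIcc 0 s hs τ) - (a + b) / 2) / h :=
      (hvc.sub continuous_const).div_const h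
    refine ⟨_, ⟨hw, fun τ => ?_⟩, ?_⟩
    · rw [abs_div]
      exact div_le_one_of_le₀ (hmem τ) (abs_nonneg h)
    · refine (inputFunctional_const_add_mul hf hw _ _).symm.trans
        (inputFunctional_congr hs fun τ hτ => ?_)
      have hsub : h = 0 → v τ - (a + b) / 2 = 0 := fun h0 =>
        abs_nonpos_iff.1 (((hcenter _).1 (hvb τ hτ)).trans_eq (by rw [h0, abs_zero]))
      simp only [projIcc_of_mem hs hτ, mul_div_cancel_of_imp' hsub, add_sub_cancel]
  · rintro _ ⟨w, ⟨hw, hw1⟩, rfl⟩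
    refine ⟨fun τ => (a + b) / 2 + h * w τ, ⟨by fun_prop, fun τ _ => ?_⟩,
      inputFunctional_const_add_mul hf hw _ _⟩
    rw [hcenter, add_sub_cancel_left, abs_mul]
    exact mul_le_of_le_one_right (abs_nonneg h) (hw1 τ)

theorem isLUB_inputFunctional_contInputs (hs : 0 ≤ s) (hf : Continuous f) (hab : a ≤ b) :
    IsLUB (inputFunctional f s '' contInputs s a b)
      ((a + b) / 2 * (1 - ∫ τ in (0 : ℝ)..s, f τ) +
        (b - a) / 2 * ((∫ τ in (0 : ℝ)..s, |f τ|) + 1)) := by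
  have hab2 : 0 ≤ (b - a) / 2 := by linarith
  rw [inputFunctional_image_contInputs hs hf (abs_of_nonneg hab2)]
  exact (isLUB_inputFunctional_continuous hs hf).isLUB_of_tendsto
    ((monotone_id.const_mul hab2).const_add _ |>.monotoneOn _)
    ⟨_, 0, ⟨continuous_zero, by simp⟩, rfl⟩
    ((continuous_const.add (continuous_const_mul _)).tendsto _ |>.mono_left nhdsWithin_le_nhds)

theorem isGLB_inputFunctional_contInputs (hs : 0 ≤ s) (hf : Continuous f) (hab : a ≤ b) :
    IsGLB (inputFunctional f s '' contInputs s a b)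
      ((a + b) / 2 * (1 - ∫ τ in (0 : ℝ)..s, f τ) +
        -((b - a) / 2) * ((∫ τ in (0 : ℝ)..s, |f τ|) + 1)) := by
  have hab2 : 0 ≤ (b - a) / 2 := by linarith
  rw [inputFunctional_image_contInputs hs hf (h := -((b - a) / 2)) (by
    rw [abs_neg, abs_of_nonneg hab2])]
  exact (isLUB_inputFunctional_continuous hs hf).isGLB_of_tendsto
    ((antitone_mul_left (neg_nonpos.2 hab2)).const_add _ |>.antitoneOn _)
    ⟨_, 0, ⟨continuous_zero, by simp⟩, rfl⟩
    ((continuous_const.add (continuous_const_mul _)).tendsto _ |>.mono_left nhdsWithin_le_nhds)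

theorem continuous_dotProduct_exp_smul_mulVec {n : Type*} [Fintype n] [DecidableEq n]
    (M : Matrix n n ℝ) (c y : n → ℝ) :
    Continuous fun r : ℝ => c ⬝ᵥ (NormedSpace.exp (r • M) *ᵥ y) := by
  let : NormedRing (Matrix n n ℝ) := Matrix.linftyOpNormedRing
  let : NormedAlgebra ℝ (Matrix n n ℝ) := Matrix.linftyOpNormedAlgebra
  let : NormedAlgebra ℚ (Matrix n n ℝ) := NormedAlgebra.restrictScalars ℚ ℝ _
  have hexp : Continuous fun r : ℝ => NormedSpace.exp (r • M) :=
    NormedSpace.exp_continuous.comp (continuous_id.smul continuous_const)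
  exact continuous_const.dotProduct (hexp.matrix_mulVec continuous_const)

theorem continuous_integral_comp_sub_left (hf : Continuous f) :
    Continuous fun s => ∫ τ in (0 : ℝ)..s, f (s - τ) := by
  simp only [intervalIntegral.integral_comp_sub_left, sub_self, sub_zero]
  exact intervalIntegral.continuous_primitive (fun a b => hf.intervalIntegrable a b) 0

variable {m : ℕ}

theorem IsInducedByLTI.isContinuousRange {x₀ : Fin (m + 1) → ℝ} {umin umax : ℝ → ℝ}
    (h : IsInducedByLTI x₀ umin umax) (t : ℝ) : IsContinuousRange t umin umax := by
  obtain ⟨A, b, z₀, vmin, vmax, -, hv, -, rfl, rfl⟩ := h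
  let k : ℝ → ℝ := fun r => cvec A ⬝ᵥ (NormedSpace.exp (r • Acon A b) *ᵥ bcon m)
  have hk : Continuous k := continuous_dotProduct_exp_smul_mulVec _ _ _
  have hfree := (continuous_dotProduct_exp_smul_mulVec (Acon A b) (cvec A) (Mmat A b *ᵥ z₀)).neg
  have hker : ∀ s, Continuous (fker A b s) := fun s => hk.comp (continuous_const.sub continuous_id)
  have hne : ∀ s, (Ifun A b s '' contInputs s vmin vmax).Nonempty := fun s =>
    ⟨_, fun _ => vmin, ⟨continuousOn_const, fun _ _ => ⟨le_rfl, hv⟩⟩, rfl⟩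
  have hglb s (hs : s ∈ Icc 0 t) := isGLB_inputFunctional_contInputs hs.1 (hker s) hv
  have hlub s (hs : s ∈ Icc 0 t) := isLUB_inputFunctional_contInputs hs.1 (hker s) hv
  have hcenter : Continuous fun s => ∫ τ in (0 : ℝ)..s, fker A b s τ :=
    continuous_integral_comp_sub_left hk
  have hradius : Continuous fun s => ∫ τ in (0 : ℝ)..s, |fker A b s τ| :=
    continuous_integral_comp_sub_left hk.abs
  refine ⟨hfree.continuousOn.add (ContinuousOn.congr ?_ fun s hs => (hglb s hs).csInf_eq (hne s)),
    hfree.continuousOn.add (ContinuousOn.congr ?_ fun s hs => (hlub s hs).csSup_eq (hne s)),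
    fun s hs => ?_⟩
  · fun_prop
  · fun_prop
  · exact (add_le_add_iff_left _).2 (csInf_le_csSup (hne s) ⟨_, (hglb s hs).1⟩ ⟨_, (hlub s hs).1⟩)

end InducedRange

end LTIReach

theorem theorem3 (m : ℕ) (t : ℝ) (ht : 0 < t) (x₀ : Fin (m + 1) → ℝ) (umin umax : ℝ → ℝ)
    (hrange : LTIReach.IsInducedByLTI x₀ umin umax ∨ LTIReach.IsContinuousRange t umin umax) :
    -- the map `π` takes its values in the reach set and is onto it
    Set.MapsTo (LTIReach.piMap t x₀ umin umax) (LTIReach.weyl m t ×ˢ Set.Icc (0 : ℝ) 1)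
      (LTIReach.reachSet t x₀ umin umax) ∧
    Set.SurjOn (LTIReach.piMap t x₀ umin umax) (LTIReach.weyl m t ×ˢ Set.Icc (0 : ℝ) 1)
      (LTIReach.reachSet t x₀ umin umax) ∧
    -- the same for continuous inputs, up to closure
    (∀ x ∈ LTIReach.contReachSet t x₀ umin umax, ∃ σ ∈ LTIReach.weyl m t,
      ∃ r ∈ Set.Icc (0 : ℝ) 1, x = r • LTIReach.xUpper t x₀ umin umax σ
        + (1 - r) • LTIReach.xLower t x₀ umin umax σ) ∧
    LTIReach.piMap t x₀ umin umax '' (LTIReach.weyl m t ×ˢ Set.Icc (0 : ℝ) 1)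
      = closure (LTIReach.contReachSet t x₀ umin umax) ∧
    -- `x^upper(σ)` and `x^lower(σ)` are boundary points, antipodal about the center
    ∀ σ ∈ LTIReach.weyl m t,
      LTIReach.xUpper t x₀ umin umax σ ∈ frontier (LTIReach.reachSet t x₀ umin umax) ∧
      LTIReach.xLower t x₀ umin umax σ ∈ frontier (LTIReach.reachSet t x₀ umin umax) ∧
      LTIReach.xUpper t x₀ umin umax σ ∈ frontier (LTIReach.contReachSet t x₀ umin umax) ∧
      LTIReach.xLower t x₀ umin umax σ ∈ frontier (LTIReach.contReachSet t x₀ umin umax) ∧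
      LTIReach.xLower t x₀ umin umax σ - LTIReach.eta t x₀ umin umax
        = -(LTIReach.xUpper t x₀ umin umax σ - LTIReach.eta t x₀ umin umax) := by
  have hr : LTIReach.IsContinuousRange t umin umax := hrange.elim (·.isContinuousRange t) id
  have himage := LTIReach.image_piMap_eq_reachSet (x₀ := x₀) ht.le hr
  have hclosure := LTIReach.closure_contReachSet (x₀ := x₀) ht.le hr
  refine ⟨Set.mapsTo_iff_image_subset.2 himage.subset, himage.superset, fun x hx => ?_,
    himage.trans hclosure.symm, fun σ hσ => ?_⟩
  · obtain ⟨⟨σ, r⟩, ⟨hσ, hr1⟩, rfl⟩ :=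
      himage.superset (LTIReach.contReachSet_subset_reachSet ht.le hr hx)
    exact ⟨σ, hσ, r, hr1, rfl⟩
  · have hupper := LTIReach.xUpper_mem_frontier (x₀ := x₀) ht.le hr hσ
    have hlower := LTIReach.xLower_mem_frontier (x₀ := x₀) ht.le hr hσ
    refine ⟨hupper.1, hlower.1, hupper.2, hlower.2, ?_⟩
    simp only [LTIReach.xLower, LTIReach.xUpper, sub_sub_cancel_left, add_sub_cancel_left]
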